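/- **Theorem 3.1 (improved dynamic trace estimation, nuclear norm).** There is a universal constant $C>0$ such that the following holds. Let $n\ge 0$ and $m\ge 1$ be integers, $0<\alpha<1$, $0<\delta<1$ and $\varepsilon>0$. There is a randomized, adaptive, online matrix-vector query algorithm which, on every sequence of real $n\times n$ matrices $A_1,\dots,A_m$ with 1. $\|A_i\|_*\le 1$ for all $i\le m$, and 2. $\|A_{i+1}-A_i\|_*\le\alpha$ for all $i\le m-1$, outputs estimates $t_1,\dots,t_m$ such that for each $i\in\{1,\dots,m\}$ $$|t_i-\operatorname{tr}(A_i)|\le\varepsilon\quad\text{with probability at least }1-\delta ,$$ and which uses in total at most $$C\left(\frac{(m\alpha+1)\,\log^2(2/\alpha)\,\sqrt{\log(1/(\alpha\delta))}}{\varepsilon}+\bigl(m\min(1,\alpha/\varepsilon)+1\bigr)\log\frac1{\alpha\delta}\right)$$ matrix-vector queries. Here $\|\cdot\|_*$ is the nuclear norm (the sum of the singular values). The algorithm knows $n,m,\alpha,\delta,\varepsilon$, but it has access to the matrices only through queries: a query names an index $j$ and a vector $x\in\mathbb R^n$, which may depend on the random seed of the algorithm and on all earlier answers, and is answered by $A_jx$.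 Online means that $t_i$ is output before any of $A_{i+1},\dots,A_m$ is queried. Arithmetic is exact (real RAM). -/

import Mathlib

open MeasureTheory

/-- The nuclear norm (Schatten 1-norm) of a real square matrix: the sum of its singular values. -/
noncomputable def nuclearNorm {n : ℕ} (A : Matrix (Fin n) (Fin n) ℝ) : ℝ :=
  ∑ i ∈ Finset.range n, (Matrix.toEuclideanLin A).singularValues i

/-- A randomized, adaptive, online algorithm (real RAM model) that accesses a stream of `m` real
`n × n` matrices `A 0, …, A (m - 1)` only through matrix-vector products, and outputs one real
estimate per matrix.

All randomness is a seed `ω` drawn at the start from the probability space `(Ω, P)`. The queries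
are numbered `0, 1, 2, …`; the `k`-th one asks for the product of one matrix of the stream with one
vector, both of which are chosen as measurable functions of the seed and of the `k` earlier answers.
The `i`-th estimate is produced after the first `queriesBefore i` queries, as a measurable function
of the seed and of the answers to those queries. The algorithm is online: the queries made before
the `i`-th estimate is output go to matrices `A j` with `j ≤ i` only. The matrices themselves are
not visible to the algorithm in any other way. -/
structure OnlineMatVecAlgorithm (n m : ℕ) where
  /-- the seeds -/
  Ω : Type
  [measurableSpace : MeasurableSpace Ω]
  /-- the law of the seed -/
  P : Measure Ω
  [isProbabilityMeasure : IsProbabilityMeasure P]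
  /-- index of the matrix to which the `k`-th query goes -/
  target : (k : ℕ) → Ω → (Fin k → Fin n → ℝ) → Fin m
  /-- vector of the `k`-th query -/
  vector : (k : ℕ) → Ω → (Fin k → Fin n → ℝ) → (Fin n → ℝ)
  /-- number of queries made before the `i`-th estimate is output -/
  queriesBefore : Fin m → ℕ
  /-- the `i`-th estimate -/
  estimate : (i : Fin m) → Ω → (Fin (queriesBefore i) → Fin n → ℝ) → ℝ
  measurable_target : ∀ k, Measurable (Function.uncurry (target k))
  measurable_vector : ∀ k, Measurable (Function.uncurry (vector k))
  measurable_estimate : ∀ i, Measurable (Function.uncurry (estimate i))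
  monotone_queriesBefore : Monotone queriesBefore
  online : ∀ (i : Fin m) (k : ℕ), k < queriesBefore i →
    ∀ (ω : Ω) (h : Fin k → Fin n → ℝ), target k ω h ≤ i

namespace OnlineMatVecAlgorithm

variable {n m : ℕ} (alg : OnlineMatVecAlgorithm n m)

instance : MeasurableSpace alg.Ω := alg.measurableSpace

instance : IsProbabilityMeasure alg.P := alg.isProbabilityMeasure

/-- The answers to the first `k` queries when the algorithm is run with seed `ω` on the stream `A`:
the answer to a query with target `j` and vector `x` is the product of `A j` with `x`. -/
def answers (A : Fin m → Matrix (Fin n) (Fin n) ℝ) (ω : alg.Ω) : (k : ℕ) → Fin k → Fin n → ℝ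
  | 0 => fun l => l.elim0
  | k + 1 =>
    Fin.snoc (α := fun _ => Fin n → ℝ) (answers A ω k)
      (Matrix.mulVec (A (alg.target k ω (answers A ω k))) (alg.vector k ω (answers A ω k)))

/-- The `i`-th output of the algorithm when it is run with seed `ω` on the stream `A`. -/
def output (A : Fin m → Matrix (Fin n) (Fin n) ℝ) (i : Fin m) (ω : alg.Ω) : ℝ :=
  alg.estimate i ω (alg.answers A ω (alg.queriesBefore i))

/-- The total number of matrix-vector queries made until all `m` estimates have been output. -/
def totalQueries : ℕ := Finset.univ.sup alg.queriesBefore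

end OnlineMatVecAlgorithm

/-!
The stream is cut into increments along a binary indexed tree: a time `i` that is an odd multiple of
`2 ^ l` is compared to the time `i - 2 ^ l`, and every time is reached from a multiple of `2 ^ K`
through at most `K` such increments, where `2 ^ K α ≥ 1`. An increment of level `l` has nuclear norm
at most `2 ^ l α`, and there are at most `m / 2 ^ l` of them, so that each of the `O(log (2 / α))`
levels costs the same if all increments are estimated with accuracy `η = ε / (2 (K + 1))`. If
`ε > α`, the scheme runs on the multiples of `w ≈ ε / (2 α)` only (`dyadicScheme`,
`exists_dyadic_algorithm`).

It remains to estimate the trace of one matrix `D` with `‖D‖_* ≤ s` within `η`, with failure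
probability `2 * 2⁻ˡ`, from `O(s √l / η + l)` products (`exists_probeSize`). The matrix is deflated
adaptively: if `E` is the product of the projections so far and `R = E D` the residual, the next
projection removes the direction `R g` for a random sign vector `g`. With `F = ‖R‖_F²` and
`G = ‖Rᵀ R‖_F²`, one deflation lowers `F` by `‖Rᵀ R g‖² / ‖R g‖²`, which is of order `G / F` by a
comparison of second and fourth moments, and `G / F ≥ F² / s²` by Hölder's inequality for the
singular values (`NuclearLE.trace_cube_le`). Hence `s² / F` tends to grow by a constant: the
expectation of `exp (-s² / F)` contracts by the factor `5 / 6` (`expect_potential_deflate_le`), and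
after `O(k + l)` deflations `F ≤ s² / k` up to probability `exp (-l)`. The trace of the deflated part
is computed exactly, and that of the residual by a median of means of Hutchinson's estimator
`gᵀ R g`, whose variance is at most `2 F` (`prob_hutchinson_mean_le`, `abs_median_sub_le`).

The cost of this is of the required order as long as `L = log (1 / (α δ))` is bounded below. If `L`
is small, the success probability asked for is only `1 - δ ≤ L`. Then estimates of accuracy
`ε / √L` with success probability `1 / 2` are enough, since random noise of this amplitude brings
the output within `ε` with conditional probability of order `√L` (`exists_noisy_algorithm`).
-/

open Matrix
open scoped BigOperators

/-! ### Duality for the nuclear norm -/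

/-- `X` does not increase the Euclidean norm. -/
def IsContraction {n : ℕ} (X : Matrix (Fin n) (Fin n) ℝ) : Prop :=
  ∀ x, (X *ᵥ x) ⬝ᵥ (X *ᵥ x) ≤ x ⬝ᵥ x

/-- The bound `‖D‖_* ≤ s` in dual form: the pairing of `D` with every contraction is at most `s`. -/
def NuclearLE {n : ℕ} (D : Matrix (Fin n) (Fin n) ℝ) (s : ℝ) : Prop :=
  ∀ X, IsContraction X → (X * D).trace ≤ s

/-- The singular value decomposition, up to normalization of the left singular vectors. -/
theorem exists_right_singular_basis {n : ℕ} (R : Matrix (Fin n) (Fin n) ℝ) :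
    ∃ (U : Matrix (Fin n) (Fin n) ℝ) (σ : Fin n → ℝ), Uᵀ * U = 1 ∧
      (R * U)ᵀ * (R * U) = diagonal (fun i => σ i ^ 2) ∧ (∀ i, 0 ≤ σ i) ∧
      ∑ i, σ i = nuclearNorm R := by
  set T := Matrix.toEuclideanLin R with hT
  have hn : Module.finrank ℝ (EuclideanSpace ℝ (Fin n)) = n := finrank_euclideanSpace_fin
  have hsym := T.isSymmetric_adjoint_comp_self
  set b := hsym.eigenvectorBasis hn with hb
  have hinner : ∀ x y : EuclideanSpace ℝ (Fin n), inner ℝ x y = x.ofLp ⬝ᵥ y.ofLp := by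
    intro x y
    simp [PiLp.inner_apply, dotProduct, mul_comm]
  refine ⟨Matrix.of fun i j => b j i, fun i => T.singularValues i, ?_, ?_, ?_, ?_⟩
  · ext i j
    have h := orthonormal_iff_ite.1 b.orthonormal i j
    rw [hinner] at h
    simpa [Matrix.mul_apply, dotProduct, Matrix.one_apply] using h
  · ext i j
    have h : inner ℝ (T (b i)) (T (b j)) = if i = j then T.singularValues i ^ 2 else 0 := by
      rw [← LinearMap.adjoint_inner_right]
      have h1 := hsym.apply_eigenvectorBasis hn j
      rw [LinearMap.comp_apply] at h1
      rw [h1, inner_smul_right, orthonormal_iff_ite.1 b.orthonormal i j,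
        T.sq_singularValues_fin hn]
      by_cases hij : i = j
      · subst hij; simp
      · simp [hij]
    rw [hinner] at h
    rw [diagonal_apply]
    exact h
  · intro i
    exact T.singularValues_nonneg i
  · rw [nuclearNorm, Finset.sum_range]

theorem dotProduct_self_nonneg' {n : ℕ} (x : Fin n → ℝ) : 0 ≤ x ⬝ᵥ x :=
  Finset.sum_nonneg fun i _ => mul_self_nonneg (x i)

theorem dotProduct_sq_le {n : ℕ} (x y : Fin n → ℝ) :
    (x ⬝ᵥ y) ^ 2 ≤ (x ⬝ᵥ x) * (y ⬝ᵥ y) := by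
  have := Finset.sum_mul_sq_le_sq_mul_sq Finset.univ x y
  simpa [dotProduct, pow_two] using this

theorem trace_eq_sum_of_orthogonal {n : ℕ} {U : Matrix (Fin n) (Fin n) ℝ} (hU : Uᵀ * U = 1)
    (M : Matrix (Fin n) (Fin n) ℝ) : M.trace = ∑ i, U.col i ⬝ᵥ (M *ᵥ U.col i) := by
  have h : (Uᵀ * (M * U)).trace = M.trace := by
    rw [trace_mul_comm, Matrix.mul_assoc, mul_eq_one_comm.1 hU, Matrix.mul_one]
  rw [← h]
  rfl

theorem NuclearLE.of_nuclearNorm_le {n : ℕ} {D : Matrix (Fin n) (Fin n) ℝ} {s : ℝ}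
    (h : nuclearNorm D ≤ s) : NuclearLE D s := by
  intro X hX
  obtain ⟨U, σ, hU, hRU, hσ, hsum⟩ := exists_right_singular_basis D
  refine le_trans ?_ h
  rw [← hsum, trace_eq_sum_of_orthogonal hU]
  refine Finset.sum_le_sum fun i _ => ?_
  have h1 : U.col i ⬝ᵥ U.col i = 1 := by
    have := congrFun (congrFun hU i) i
    simpa [Matrix.mul_apply, dotProduct] using this
  have h2 : (D *ᵥ U.col i) ⬝ᵥ (D *ᵥ U.col i) = σ i ^ 2 := by
    have := congrFun (congrFun hRU i) i
    simpa [Matrix.mul_apply, dotProduct, Matrix.mulVec, mul_comm] using this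
  have h3 := dotProduct_sq_le (U.col i) ((X * D) *ᵥ U.col i)
  rw [h1, one_mul, ← Matrix.mulVec_mulVec] at h3
  have h4 := hX (D *ᵥ U.col i)
  rw [h2] at h4
  rw [← Matrix.mulVec_mulVec]
  exact abs_le_of_sq_le_sq' (h3.trans h4) (hσ i) |>.2

theorem NuclearLE.add {n : ℕ} {D D' : Matrix (Fin n) (Fin n) ℝ} {s s' : ℝ}
    (h : NuclearLE D s) (h' : NuclearLE D' s') : NuclearLE (D + D') (s + s') := by
  intro X hX
  rw [Matrix.mul_add, trace_add]
  exact add_le_add (h X hX) (h' X hX)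

theorem NuclearLE.mul_left {n : ℕ} {D E : Matrix (Fin n) (Fin n) ℝ} {s : ℝ}
    (h : NuclearLE D s) (hE : IsContraction E) : NuclearLE (E * D) s := by
  intro X hX
  rw [← Matrix.mul_assoc]
  refine h _ fun x => ?_
  rw [← Matrix.mulVec_mulVec]
  exact (hX _).trans (hE x)

theorem NuclearLE.abs_trace_le {n : ℕ} {D : Matrix (Fin n) (Fin n) ℝ} {s : ℝ}
    (h : NuclearLE D s) : |D.trace| ≤ s := by
  have h1 := h 1 (fun x => by simp)
  have h2 := h (-1) (fun x => by simp [neg_mulVec])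
  simp only [Matrix.one_mul, Matrix.neg_mul, trace_neg] at h1 h2
  exact abs_le.2 ⟨by linarith, h1⟩

/-- Bessel's inequality for the columns of `W`. -/
theorem isContraction_transpose_of_gram {n : ℕ} {W : Matrix (Fin n) (Fin n) ℝ} {p : Fin n → ℝ}
    (hW : Wᵀ * W = diagonal p) (hp : ∀ i, p i ≤ 1) : IsContraction Wᵀ := by
  intro x
  set y := Wᵀ *ᵥ x with hy
  have h1 : (W *ᵥ y) ⬝ᵥ x = y ⬝ᵥ y := by
    rw [dotProduct_comm, dotProduct_mulVec, ← mulVec_transpose]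
  have h2 : (W *ᵥ y) ⬝ᵥ (W *ᵥ y) ≤ y ⬝ᵥ y := by
    rw [dotProduct_mulVec, ← mulVec_transpose, mulVec_mulVec, hW, dotProduct, dotProduct]
    refine Finset.sum_le_sum fun i _ => ?_
    rw [mulVec_diagonal]
    nlinarith [mul_self_nonneg (y i), hp i]
  have h3 := dotProduct_self_nonneg' (x - W *ᵥ y)
  rw [sub_dotProduct, dotProduct_sub, dotProduct_sub, dotProduct_comm x (W *ᵥ y), h1] at h3
  linarith

/-- The nuclear norm of `R` bounds the sum of its singular values, in the dual form. -/
theorem NuclearLE.sum_singular_le {n : ℕ} {R U : Matrix (Fin n) (Fin n) ℝ} {σ : Fin n → ℝ} {s : ℝ}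
    (h : NuclearLE R s) (hU : Uᵀ * U = 1)
    (hRU : (R * U)ᵀ * (R * U) = diagonal (fun i => σ i ^ 2)) : ∑ i, σ i ≤ s := by
  -- the contraction is the transpose of the polar factor of `R`; zero singular values are ignored
  -- since `0⁻¹ = 0`
  set S : Matrix (Fin n) (Fin n) ℝ := diagonal fun i => (σ i)⁻¹ with hS
  have hSt : Sᵀ = S := diagonal_transpose _
  have hW : (R * U * S)ᵀ * (R * U * S) = diagonal (fun i => (σ i)⁻¹ * σ i ^ 2 * (σ i)⁻¹) := by
    rw [transpose_mul, hSt, Matrix.mul_assoc, ← Matrix.mul_assoc _ _ S, hRU, hS,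
      diagonal_mul_diagonal, diagonal_mul_diagonal]
    simp only [mul_assoc]
  have hX : IsContraction (U * (R * U * S)ᵀ) := by
    have hc := isContraction_transpose_of_gram hW fun i => by
      by_cases h0 : σ i = 0
      · simp [h0]
      · field_simp; rfl
    intro x
    rw [← mulVec_mulVec, dotProduct_mulVec, ← mulVec_transpose, mulVec_mulVec, hU, one_mulVec]
    exact hc x
  refine le_trans (le_of_eq ?_) (h _ hX)
  have h1 : (U * (R * U * S)ᵀ * R).trace = (S * ((R * U)ᵀ * (R * U))).trace := by
    rw [Matrix.mul_assoc, trace_mul_comm, transpose_mul (R * U) S, hSt]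
    simp only [Matrix.mul_assoc]
  rw [h1, hRU, hS, diagonal_mul_diagonal, trace_diagonal]
  refine Finset.sum_congr rfl fun i _ => ?_
  by_cases h0 : σ i = 0
  · simp [h0]
  · field_simp

/-- Hölder's inequality `(∑ σ²)³ ≤ (∑ σ)² ∑ σ⁴` for the singular values of `R`. -/
theorem NuclearLE.trace_cube_le {n : ℕ} {R : Matrix (Fin n) (Fin n) ℝ} {s : ℝ}
    (h : NuclearLE R s) :
    (Rᵀ * R).trace ^ 3 ≤ s ^ 2 * ((Rᵀ * R) * (Rᵀ * R)).trace := by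
  obtain ⟨U, σ, hU, hRU, hσ, -⟩ := exists_right_singular_basis R
  have hs := h.sum_singular_le hU hRU
  have hU' : U * Uᵀ = 1 := mul_eq_one_comm.1 hU
  have hH : Rᵀ * R = U * diagonal (fun i => σ i ^ 2) * Uᵀ := by
    rw [← hRU, transpose_mul]
    calc Rᵀ * R = (U * Uᵀ) * (Rᵀ * R) * (U * Uᵀ) := by rw [hU', Matrix.one_mul, Matrix.mul_one]
      _ = _ := by simp only [Matrix.mul_assoc]
  have hF : (Rᵀ * R).trace = ∑ i, σ i ^ 2 := by
    rw [hH, trace_mul_comm, ← Matrix.mul_assoc, hU, Matrix.one_mul, trace_diagonal]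
  have hG : ((Rᵀ * R) * (Rᵀ * R)).trace = ∑ i, σ i ^ 4 := by
    have : (Rᵀ * R) * (Rᵀ * R) = U * diagonal (fun i => σ i ^ 4) * Uᵀ := by
      calc (Rᵀ * R) * (Rᵀ * R)
          = U * diagonal (fun i => σ i ^ 2) * (Uᵀ * U) * diagonal (fun i => σ i ^ 2) * Uᵀ := by
            rw [hH]; simp only [Matrix.mul_assoc]
        _ = _ := by
            rw [hU, Matrix.mul_one, Matrix.mul_assoc U, diagonal_mul_diagonal]
            simp only [← pow_add]
    rw [this, trace_mul_comm, ← Matrix.mul_assoc, hU, Matrix.one_mul, trace_diagonal]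
  rw [hF, hG]
  have hF0 : 0 ≤ ∑ i, σ i ^ 2 := Finset.sum_nonneg fun i _ => by positivity
  have hG0 : 0 ≤ ∑ i, σ i ^ 4 := Finset.sum_nonneg fun i _ => by positivity
  have h30 : 0 ≤ ∑ i, σ i ^ 3 := Finset.sum_nonneg fun i _ => pow_nonneg (hσ i) 3
  have h10 : 0 ≤ ∑ i, σ i := Finset.sum_nonneg fun i _ => hσ i
  -- the Cauchy–Schwarz inequality, twice
  have c1 : (∑ i, σ i ^ 2) ^ 2 ≤ (∑ i, σ i) * ∑ i, σ i ^ 3 :=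
    Finset.sum_sq_le_sum_mul_sum_of_sq_le_mul _ (fun i _ => hσ i)
      (fun i _ => pow_nonneg (hσ i) 3) fun i _ => le_of_eq (by ring)
  have c2 : (∑ i, σ i ^ 3) ^ 2 ≤ (∑ i, σ i ^ 2) * ∑ i, σ i ^ 4 :=
    Finset.sum_sq_le_sum_mul_sum_of_sq_le_mul _ (fun i _ => by positivity)
      (fun i _ => by positivity) fun i _ => le_of_eq (by ring)
  rcases hF0.eq_or_lt with h0 | h0
  · rw [← h0, zero_pow three_ne_zero]; positivity
  · have c3 : ((∑ i, σ i ^ 2) ^ 2) ^ 2 ≤ (s * ∑ i, σ i ^ 3) ^ 2 := by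
      gcongr
      exact c1.trans (by gcongr)
    have c4 : (s * ∑ i, σ i ^ 3) ^ 2 ≤ s ^ 2 * ((∑ i, σ i ^ 2) * ∑ i, σ i ^ 4) := by
      rw [mul_pow]; gcongr
    refine le_of_mul_le_mul_left ?_ h0
    linarith [c3.trans c4]

/-! ### Moments of random signs -/

/-- The vector of signs `±1` encoded by a Boolean vector. -/
def signVec {n : ℕ} (x : Fin n → Bool) : Fin n → ℝ := fun i => if x i then 1 else -1

theorem signVec_cons {n : ℕ} (c : Bool) (x : Fin n → Bool) :
    signVec (Fin.cons c x : Fin (n + 1) → Bool) = Fin.cons (if c then 1 else -1) (signVec x) := by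
  ext i
  refine Fin.cases ?_ (fun j => ?_) i <;> simp [signVec]

theorem expect_cons {n : ℕ} (f : (Fin (n + 1) → Bool) → ℝ) :
    𝔼 x, f x = 𝔼 x : Fin n → Bool, (f (Fin.cons true x) + f (Fin.cons false x)) / 2 := by
  have h1 : 𝔼 x, f x = 𝔼 p : Bool × (Fin n → Bool), f (Fin.cons p.1 p.2) :=
    (Fintype.expect_equiv (Fin.consEquiv fun _ => Bool) _ _ fun p => rfl).symm
  rw [h1, ← Finset.univ_product_univ, Finset.expect_product, Finset.expect_comm]
  refine Finset.expect_congr rfl fun x _ => ?_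
  rw [Fintype.expect_eq_sum_div_card]
  simp

theorem expect_sign_mul {n : ℕ} (r u : Fin n → ℝ) :
    𝔼 x, (r ⬝ᵥ signVec x) * (u ⬝ᵥ signVec x) = r ⬝ᵥ u := by
  induction n with
  | zero => simp
  | succ n ih =>
    rw [expect_cons]
    have h : ∀ x : Fin n → Bool,
        ((r ⬝ᵥ signVec (Fin.cons true x : Fin (n + 1) → Bool)) *
            (u ⬝ᵥ signVec (Fin.cons true x : Fin (n + 1) → Bool)) +
          (r ⬝ᵥ signVec (Fin.cons false x : Fin (n + 1) → Bool)) *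
            (u ⬝ᵥ signVec (Fin.cons false x : Fin (n + 1) → Bool))) / 2 =
        (vecTail r ⬝ᵥ signVec x) * (vecTail u ⬝ᵥ signVec x) + r 0 * u 0 := by
      intro x
      simp only [signVec_cons, dotProduct, Fin.sum_univ_succ, vecTail]
      simp
      ring
    simp only [h]
    rw [Finset.expect_add_distrib, ih, Fintype.expect_const]
    simp [dotProduct, Fin.sum_univ_succ, vecTail]
    ring

/-- Khintchine's inequality for fourth moments, in bilinear form. -/
theorem expect_sign_sq_mul_sq_le {n : ℕ} (r u : Fin n → ℝ) :
    𝔼 x, (r ⬝ᵥ signVec x) ^ 2 * (u ⬝ᵥ signVec x) ^ 2 ≤ 3 * ((r ⬝ᵥ r) * (u ⬝ᵥ u)) := by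
  induction n with
  | zero => simp
  | succ n ih =>
    rw [expect_cons]
    have h : ∀ x : Fin n → Bool,
        ((r ⬝ᵥ signVec (Fin.cons true x : Fin (n + 1) → Bool)) ^ 2 *
            (u ⬝ᵥ signVec (Fin.cons true x : Fin (n + 1) → Bool)) ^ 2 +
          (r ⬝ᵥ signVec (Fin.cons false x : Fin (n + 1) → Bool)) ^ 2 *
            (u ⬝ᵥ signVec (Fin.cons false x : Fin (n + 1) → Bool)) ^ 2) / 2 =
        (vecTail r ⬝ᵥ signVec x) ^ 2 * (vecTail u ⬝ᵥ signVec x) ^ 2 +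
          (u 0 ^ 2 * ((vecTail r ⬝ᵥ signVec x) * (vecTail r ⬝ᵥ signVec x)) +
          r 0 ^ 2 * ((vecTail u ⬝ᵥ signVec x) * (vecTail u ⬝ᵥ signVec x)) +
          4 * (r 0 * u 0) * ((vecTail r ⬝ᵥ signVec x) * (vecTail u ⬝ᵥ signVec x)) +
            r 0 ^ 2 * u 0 ^ 2) := by
      intro x
      simp only [signVec_cons, dotProduct, Fin.sum_univ_succ, vecTail]
      simp
      ring
    simp only [h]
    simp only [Finset.expect_add_distrib, ← Finset.mul_expect, expect_sign_mul,
      Fintype.expect_const]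
    have hr : r ⬝ᵥ r = r 0 ^ 2 + vecTail r ⬝ᵥ vecTail r := by
      simp [dotProduct, Fin.sum_univ_succ, vecTail]; ring
    have hu : u ⬝ᵥ u = u 0 ^ 2 + vecTail u ⬝ᵥ vecTail u := by
      simp [dotProduct, Fin.sum_univ_succ, vecTail]; ring
    have hI := ih (vecTail r) (vecTail u)
    have hR := dotProduct_self_nonneg' (vecTail r)
    have hU := dotProduct_self_nonneg' (vecTail u)
    have hC := dotProduct_sq_le (vecTail r) (vecTail u)
    rw [hr, hu]
    set R := vecTail r ⬝ᵥ vecTail r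
    set U := vecTail u ⬝ᵥ vecTail u
    set c := vecTail r ⬝ᵥ vecTail u
    -- `2 a b c ≤ a² U + b² R` because `c² ≤ R U`
    have key : 2 * (r 0 * u 0) * c ≤ u 0 ^ 2 * R + r 0 ^ 2 * U := by
      refine abs_le_of_sq_le_sq' ?_ (by positivity) |>.2
      nlinarith [sq_nonneg (u 0 ^ 2 * R - r 0 ^ 2 * U),
        mul_le_mul_of_nonneg_left hC (sq_nonneg (r 0 * u 0))]
    nlinarith [mul_nonneg (sq_nonneg (r 0)) (sq_nonneg (u 0))]

/-- The variance of Hutchinson's estimator `gᵀ R g` of the trace. -/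
theorem expect_hutchinson_sq_le {n : ℕ} (R : Matrix (Fin n) (Fin n) ℝ) :
    𝔼 x, (signVec x ⬝ᵥ (R *ᵥ signVec x) - R.trace) ^ 2 ≤ 2 * (Rᵀ * R).trace := by
  have htr : ∀ {n : ℕ} (R : Matrix (Fin n) (Fin n) ℝ),
      (Rᵀ * R).trace = ∑ i, ∑ j, R j i ^ 2 := fun R => by
    simp [Matrix.trace, Matrix.mul_apply, pow_two]
  induction n with
  | zero => simp [Matrix.trace]
  | succ n ih =>
    set R' : Matrix (Fin n) (Fin n) ℝ := R.submatrix Fin.succ Fin.succ with hR'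
    set a : Fin n → ℝ := fun i => R 0 i.succ with ha
    set b : Fin n → ℝ := fun i => R i.succ 0 with hb
    have hq : ∀ (σ : ℝ) (y : Fin n → ℝ), σ * σ = 1 →
        (Fin.cons σ y : Fin (n + 1) → ℝ) ⬝ᵥ (R *ᵥ (Fin.cons σ y : Fin (n + 1) → ℝ)) - R.trace =
          (y ⬝ᵥ (R' *ᵥ y) - R'.trace) + σ * ((a + b) ⬝ᵥ y) := by
      intro σ y hσ
      have h1 : (a + b) ⬝ᵥ y = ∑ i : Fin n, R 0 i.succ * y i + ∑ i : Fin n, y i * R i.succ 0 := by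
        rw [← Finset.sum_add_distrib]
        refine Finset.sum_congr rfl fun i _ => ?_
        simp [ha, hb]; ring
      rw [h1]
      simp only [dotProduct, Matrix.mulVec, Fin.sum_univ_succ, Fin.cons_zero, Fin.cons_succ,
        Matrix.trace, Matrix.diag, mul_add, Finset.sum_add_distrib, hR', submatrix_apply,
        Finset.mul_sum]
      have h2 : ∀ i, y i * (R i.succ 0 * σ) = σ * (y i * R i.succ 0) := fun i => by ring
      simp only [h2]
      linear_combination R 0 0 * hσ
    rw [expect_cons]
    have h : ∀ x : Fin n → Bool,
        ((signVec (Fin.cons true x : Fin (n + 1) → Bool) ⬝ᵥ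
            (R *ᵥ signVec (Fin.cons true x : Fin (n + 1) → Bool)) - R.trace) ^ 2 +
          (signVec (Fin.cons false x : Fin (n + 1) → Bool) ⬝ᵥ
            (R *ᵥ signVec (Fin.cons false x : Fin (n + 1) → Bool)) - R.trace) ^ 2) / 2 =
        (signVec x ⬝ᵥ (R' *ᵥ signVec x) - R'.trace) ^ 2 +
          ((a + b) ⬝ᵥ signVec x) * ((a + b) ⬝ᵥ signVec x) := by
      intro x
      rw [signVec_cons, signVec_cons, hq _ _ (by simp), hq _ _ (by simp)]
      simp
      ring
    simp only [h]
    rw [Finset.expect_add_distrib, expect_sign_mul]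
    have hI := ih R'
    have hab : (a + b) ⬝ᵥ (a + b) ≤
        2 * (∑ i : Fin n, R 0 i.succ ^ 2 + ∑ i : Fin n, R i.succ 0 ^ 2) := by
      rw [← Finset.sum_add_distrib, Finset.mul_sum]
      refine Finset.sum_le_sum fun i _ => ?_
      simp only [Pi.add_apply, ha, hb]
      nlinarith [sq_nonneg (R 0 i.succ - R i.succ 0)]
    have hT : (Rᵀ * R).trace = R 0 0 ^ 2 + ∑ i : Fin n, R 0 i.succ ^ 2 +
        ∑ i : Fin n, R i.succ 0 ^ 2 +
        (R'ᵀ * R').trace := by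
      rw [htr, htr]
      simp only [Fin.sum_univ_succ, Finset.sum_add_distrib, hR', submatrix_apply]
      ring
    rw [hT]
    nlinarith [sq_nonneg (R 0 0)]

theorem mulVec_dotProduct_self {n : ℕ} (R : Matrix (Fin n) (Fin n) ℝ) (g : Fin n → ℝ) :
    (R *ᵥ g) ⬝ᵥ (R *ᵥ g) = ∑ i, (R i ⬝ᵥ g) ^ 2 := by
  simp [dotProduct, Matrix.mulVec, pow_two]

theorem trace_transpose_mul_self {n : ℕ} (R : Matrix (Fin n) (Fin n) ℝ) :
    (Rᵀ * R).trace = ∑ i, R i ⬝ᵥ R i := by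
  simp only [Matrix.trace, Matrix.diag, Matrix.mul_apply, transpose_apply, dotProduct]
  exact Finset.sum_comm

theorem expect_norm_sq {n : ℕ} (R : Matrix (Fin n) (Fin n) ℝ) :
    𝔼 x, (R *ᵥ signVec x) ⬝ᵥ (R *ᵥ signVec x) = (Rᵀ * R).trace := by
  simp only [mulVec_dotProduct_self, trace_transpose_mul_self, Finset.expect_sum_comm, pow_two,
    expect_sign_mul]

theorem expect_norm_sq_mul_le {n : ℕ} (R S : Matrix (Fin n) (Fin n) ℝ) :
    𝔼 x, ((R *ᵥ signVec x) ⬝ᵥ (R *ᵥ signVec x)) * ((S *ᵥ signVec x) ⬝ᵥ (S *ᵥ signVec x)) ≤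
      3 * ((Rᵀ * R).trace * (Sᵀ * S).trace) := by
  simp only [mulVec_dotProduct_self, trace_transpose_mul_self, Finset.sum_mul_sum,
    Finset.expect_sum_comm]
  simp only [Finset.mul_sum]
  exact Finset.sum_le_sum fun i _ => Finset.sum_le_sum fun j _ => expect_sign_sq_mul_sq_le _ _

/-! ### Adaptive deflation -/

/-- The matrix `E` followed by the orthogonal projection away from `v`. -/
noncomputable def deflate {n : ℕ} (E : Matrix (Fin n) (Fin n) ℝ) (v : Fin n → ℝ) :
    Matrix (Fin n) (Fin n) ℝ :=
  E - (v ⬝ᵥ v)⁻¹ • vecMulVec v (v ᵥ* E)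

theorem deflate_mul {n : ℕ} (E D : Matrix (Fin n) (Fin n) ℝ) (v : Fin n → ℝ) :
    deflate E v * D = deflate (E * D) v := by
  rw [deflate, deflate, Matrix.sub_mul, smul_mul, vecMulVec_mul, vecMul_vecMul]

theorem trace_deflate {n : ℕ} (E D : Matrix (Fin n) (Fin n) ℝ) (v : Fin n → ℝ) :
    (deflate E v * D).trace = (E * D).trace - (v ⬝ᵥ v)⁻¹ * ((v ᵥ* E) ⬝ᵥ (D *ᵥ v)) := by
  rw [deflate_mul, deflate, trace_sub, trace_smul, trace_vecMulVec, smul_eq_mul, ← vecMul_vecMul,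
    dotProduct_mulVec, dotProduct_comm v (v ᵥ* E ᵥ* D)]

theorem inv_mul_self_mul (a : ℝ) : a⁻¹ * a⁻¹ * a = a⁻¹ := by
  by_cases h : a = 0
  · simp [h]
  · field_simp

theorem IsContraction.deflate {n : ℕ} {E : Matrix (Fin n) (Fin n) ℝ} (hE : IsContraction E)
    (v : Fin n → ℝ) : IsContraction (deflate E v) := by
  intro x
  refine le_trans ?_ (hE x)
  set z := E *ᵥ x with hz
  have h1 : (_root_.deflate E v) *ᵥ x = z - ((v ⬝ᵥ v)⁻¹ * (v ⬝ᵥ z)) • v := by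
    rw [_root_.deflate, sub_mulVec, smul_mulVec, vecMulVec_mulVec, ← dotProduct_mulVec, mul_smul]
    simp [hz]
  rw [h1, sub_dotProduct, dotProduct_sub, dotProduct_sub, smul_dotProduct, smul_dotProduct,
    dotProduct_smul, dotProduct_smul, dotProduct_comm z v]
  simp only [smul_eq_mul]
  have h2 := inv_mul_self_mul (v ⬝ᵥ v)
  have h3 : 0 ≤ (v ⬝ᵥ v)⁻¹ * (v ⬝ᵥ z) ^ 2 :=
    mul_nonneg (inv_nonneg.2 (dotProduct_self_nonneg' v)) (sq_nonneg _)
  linear_combination h3 + (v ⬝ᵥ z) ^ 2 * h2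

theorem trace_gram_deflate {n : ℕ} (R : Matrix (Fin n) (Fin n) ℝ) (v : Fin n → ℝ) :
    ((deflate R v)ᵀ * deflate R v).trace =
      (Rᵀ * R).trace - (v ⬝ᵥ v)⁻¹ * ((Rᵀ *ᵥ v) ⬝ᵥ (Rᵀ *ᵥ v)) := by
  have h2 := inv_mul_self_mul (v ⬝ᵥ v)
  rw [deflate, mulVec_transpose]
  set w := v ᵥ* R
  set c := (v ⬝ᵥ v)⁻¹
  have hw : (Rᵀ * vecMulVec v w).trace = w ⬝ᵥ w := by
    rw [mul_vecMulVec, mulVec_transpose, trace_vecMulVec]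
  have hw' : (vecMulVec w v * R).trace = w ⬝ᵥ w := by
    rw [vecMulVec_mul, trace_vecMulVec]
  have hvw : (vecMulVec w v * vecMulVec v w).trace = (v ⬝ᵥ v) * (w ⬝ᵥ w) := by
    rw [vecMulVec_mul_vecMulVec, trace_vecMulVec, dotProduct_smul]
    simp
  rw [transpose_sub, transpose_smul, transpose_vecMulVec, Matrix.sub_mul, Matrix.mul_sub,
    Matrix.mul_sub, Matrix.mul_smul, Matrix.mul_smul, Matrix.smul_mul, Matrix.smul_mul]
  simp only [trace_sub, trace_smul, smul_eq_mul, hw, hw', hvw]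
  linear_combination (w ⬝ᵥ w) * h2

/-- The potential `exp (-s² / F)` of a residual with squared Frobenius norm `F`; a vanishing
residual has potential `0`. -/
noncomputable def potential (s F : ℝ) : ℝ := if F ≤ 0 then 0 else Real.exp (-(s ^ 2 / F))

theorem potential_nonneg (s F : ℝ) : 0 ≤ potential s F := by
  rw [potential]; split_ifs <;> positivity

theorem potential_le_one (s F : ℝ) : potential s F ≤ 1 := by
  rw [potential]; split_ifs with h
  · exact zero_le_one
  · have := not_le.1 h
    exact Real.exp_le_one_iff.2 (by rw [neg_nonpos]; positivity)

/-- A decrease of the residual by `U / V` shrinks the potential by a factor which is bounded by a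
polynomial in `U` and `V`. The bound holds for every `θ`: it linearizes `U / (V + c U)`,
`c = F / G`. -/
theorem potential_step_le {s F G U V : ℝ} (θ : ℝ) (hF : 0 < F) (hG : 0 < G) (hU : 0 ≤ U)
    (hV : 0 ≤ V) (hUV : V = 0 → U = 0) (hFG : F ^ 3 ≤ s ^ 2 * G) :
    potential s (F - V⁻¹ * U) ≤
      potential s F * (1 - F / G * (2 * θ * U - θ ^ 2 * (U * V + F / G * (U * U)))) := by
  set c := F / G with hc
  have hc0 : 0 < c := div_pos hF hG
  have hfac : (1 + c * (V⁻¹ * U))⁻¹ ≤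
      1 - c * (2 * θ * U - θ ^ 2 * (U * V + c * (U * U))) := by
    rcases hV.eq_or_lt with h0 | h0
    · simp [hUV h0.symm]
    · have hpos : 0 < V + c * U := by positivity
      have h1 : (1 + c * (V⁻¹ * U))⁻¹ = 1 - c * (U / (V + c * U)) := by
        field_simp
        ring
      have h2 : 2 * θ * U - θ ^ 2 * (U * V + c * (U * U)) ≤ U / (V + c * U) := by
        rw [le_div_iff₀ hpos]
        nlinarith [mul_nonneg hU (sq_nonneg (1 - θ * (V + c * U)))]
      rw [h1]
      nlinarith
  have hY : 0 ≤ c * (V⁻¹ * U) := by positivity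
  have hinv : 0 ≤ (1 + c * (V⁻¹ * U))⁻¹ := by positivity
  refine le_trans ?_ (mul_le_mul_of_nonneg_left hfac (potential_nonneg s F))
  set Δ := V⁻¹ * U with hΔ
  have hΔ0 : 0 ≤ Δ := by positivity
  by_cases hF' : F - Δ ≤ 0
  · rw [potential, if_pos hF']
    exact mul_nonneg (potential_nonneg s F) hinv
  · have hF'' := not_le.1 hF'
    rw [potential, if_neg hF', potential, if_neg (not_le.2 hF)]
    have h1 : c * Δ ≤ s ^ 2 / (F - Δ) - s ^ 2 / F := by
      have h3 : c ≤ s ^ 2 / F ^ 2 := by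
        rw [hc, div_le_div_iff₀ hG (by positivity)]
        linarith
      have h4 : s ^ 2 / (F - Δ) - s ^ 2 / F = s ^ 2 / (F * (F - Δ)) * Δ := by
        field_simp
        ring
      rw [h4]
      refine mul_le_mul_of_nonneg_right (h3.trans ?_) hΔ0
      refine div_le_div_of_nonneg_left (sq_nonneg s) (by positivity) ?_
      nlinarith
    have h2 : Real.exp (-(c * Δ)) ≤ (1 + c * Δ)⁻¹ := by
      rw [Real.exp_neg]
      refine inv_anti₀ (by positivity) ?_
      linarith [Real.add_one_le_exp (c * Δ)]
    calc Real.exp (-(s ^ 2 / (F - Δ))) ≤ Real.exp (-(s ^ 2 / F)) * Real.exp (-(c * Δ)) := by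
          rw [← Real.exp_add]
          exact Real.exp_le_exp.2 (by linarith)
      _ ≤ _ := by gcongr

theorem trace_gram_nonneg {n : ℕ} (R : Matrix (Fin n) (Fin n) ℝ) : 0 ≤ (Rᵀ * R).trace := by
  rw [trace_transpose_mul_self]
  exact Finset.sum_nonneg fun i _ => dotProduct_self_nonneg' _

/-- Deflating by the image of a random sign vector decreases the expected potential by a constant
factor. -/
theorem expect_potential_deflate_le {n : ℕ} {R : Matrix (Fin n) (Fin n) ℝ} {s : ℝ}
    (h : NuclearLE R s) :
    𝔼 x, potential s (((deflate R (R *ᵥ signVec x))ᵀ * deflate R (R *ᵥ signVec x)).trace) ≤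
      5 / 6 * potential s (Rᵀ * R).trace := by
  simp only [trace_gram_deflate]
  set F := (Rᵀ * R).trace with hFdef
  have hHt : (Rᵀ * R)ᵀ = Rᵀ * R := by rw [transpose_mul, transpose_transpose]
  set G := ((Rᵀ * R) * (Rᵀ * R)).trace with hGdef
  have hFG : F ^ 3 ≤ s ^ 2 * G := h.trace_cube_le
  rcases (trace_gram_nonneg R).eq_or_lt with h0 | h0
  · rw [← hFdef] at h0
    refine le_of_eq_of_le (Finset.expect_eq_zero fun x _ => ?_)
      (mul_nonneg (by norm_num) (potential_nonneg s F))
    rw [potential, if_pos]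
    rw [← h0, zero_sub, neg_nonpos]
    exact mul_nonneg (inv_nonneg.2 (dotProduct_self_nonneg' _)) (dotProduct_self_nonneg' _)
  · rw [← hFdef] at h0
    have hG : 0 < G := by
      by_contra hG
      have : 0 < F ^ 3 := by positivity
      nlinarith [sq_nonneg s]
    -- the maximizer of the bound after the moments are inserted
    set θ := 1 / (6 * F) with hθ
    set U : (Fin n → Bool) → ℝ := fun x =>
      ((Rᵀ * R) *ᵥ signVec x) ⬝ᵥ ((Rᵀ * R) *ᵥ signVec x) with hU
    set V : (Fin n → Bool) → ℝ := fun x => (R *ᵥ signVec x) ⬝ᵥ (R *ᵥ signVec x) with hV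
    have hEU : 𝔼 x, U x = G := by
      rw [hU, expect_norm_sq, hHt]
    have hEUU : 𝔼 x, U x * U x ≤ 3 * (G * G) := by
      have := expect_norm_sq_mul_le (Rᵀ * R) (Rᵀ * R)
      rwa [hHt] at this
    have hEUV : 𝔼 x, U x * V x ≤ 3 * (G * F) := by
      have := expect_norm_sq_mul_le (Rᵀ * R) R
      rwa [hHt] at this
    have hpt : ∀ x, potential s (F - (V x)⁻¹ * U x) ≤ potential s F *
        (1 - F / G * (2 * θ * U x - θ ^ 2 * (U x * V x + F / G * (U x * U x)))) := fun x => by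
      refine potential_step_le θ h0 hG (dotProduct_self_nonneg' _) (dotProduct_self_nonneg' _)
        (fun hv => ?_) hFG
      have : R *ᵥ signVec x = 0 := dotProduct_self_eq_zero.1 hv
      simp only [hU]
      rw [← mulVec_mulVec, this]
      simp
    calc 𝔼 x, potential s (F - (V x)⁻¹ * (Rᵀ *ᵥ (R *ᵥ signVec x)) ⬝ᵥ (Rᵀ *ᵥ (R *ᵥ signVec x)))
        = 𝔼 x, potential s (F - (V x)⁻¹ * U x) := by simp only [mulVec_mulVec, hU]
      _ ≤ 𝔼 x, potential s F *
          (1 - F / G * (2 * θ * U x - θ ^ 2 * (U x * V x + F / G * (U x * U x)))) :=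
          Finset.expect_le_expect fun x _ => hpt x
      _ = potential s F * (1 - F / G * (2 * θ * G -
            θ ^ 2 * (𝔼 x, U x * V x + F / G * 𝔼 x, U x * U x))) := by
          simp only [← Finset.mul_expect, Finset.expect_sub_distrib, Finset.expect_add_distrib,
            Fintype.expect_const, hEU]
      _ ≤ potential s F * (5 / 6) := by
          refine mul_le_mul_of_nonneg_left ?_ (potential_nonneg s F)
          have h1 : θ ^ 2 * (𝔼 x, U x * V x + F / G * 𝔼 x, U x * U x) ≤
              θ ^ 2 * (3 * (G * F) + F / G * (3 * (G * G))) := by gcongr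
          have h2 : F / G * (2 * θ * G - θ ^ 2 * (3 * (G * F) + F / G * (3 * (G * G)))) = 1 / 6 := by
            rw [hθ]
            field_simp
            norm_num
          have h3 : F / G * (2 * θ * G - θ ^ 2 * (3 * (G * F) + F / G * (3 * (G * G)))) ≤
              F / G * (2 * θ * G - θ ^ 2 * (𝔼 x, U x * V x + F / G * 𝔼 x, U x * U x)) := by
            gcongr
          linarith
      _ = _ := mul_comm _ _

/-- The successive deflations by a sequence of vectors: a product of orthogonal projections whose
kernel contains the first `t` vectors. -/
noncomputable def deflation {n : ℕ} (y : ℕ → Fin n → ℝ) : ℕ → Matrix (Fin n) (Fin n) ℝ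
  | 0 => 1
  | t + 1 => deflate (deflation y t) (deflation y t *ᵥ y t)

theorem deflation_congr {n : ℕ} {y y' : ℕ → Fin n → ℝ} {t : ℕ} (h : ∀ i < t, y i = y' i) :
    deflation y t = deflation y' t := by
  induction t with
  | zero => rfl
  | succ t ih =>
    rw [deflation, deflation, ih fun i hi => h i (hi.trans t.lt_succ_self), h t t.lt_succ_self]

theorem isContraction_deflation {n : ℕ} (y : ℕ → Fin n → ℝ) (t : ℕ) :
    IsContraction (deflation y t) := by
  induction t with
  | zero => intro x; simp [deflation]
  | succ t ih => exact ih.deflate _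

/-- The trace of the deflated part of `D` is known from the products of `D` with the deflated
directions. -/
theorem trace_eq_sum_add_trace_deflation {n : ℕ} (D : Matrix (Fin n) (Fin n) ℝ)
    (y : ℕ → Fin n → ℝ) (T : ℕ) :
    D.trace = ∑ t ∈ Finset.range T,
      ((deflation y t *ᵥ y t) ⬝ᵥ (deflation y t *ᵥ y t))⁻¹ *
        (((deflation y t *ᵥ y t) ᵥ* deflation y t) ⬝ᵥ (D *ᵥ (deflation y t *ᵥ y t))) +
      (deflation y T * D).trace := by
  induction T with
  | zero => simp [deflation]
  | succ T ih =>
    rw [Finset.sum_range_succ, deflation, trace_deflate, ih]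
    ring

/-- Resampling one coordinate of a uniformly random point does not change expectations. -/
theorem expect_update {ι X : Type*} [Fintype ι] [DecidableEq ι] [Fintype X] [Nonempty X]
    (f : (ι → X) → ℝ) (i : ι) : 𝔼 ω, f ω = 𝔼 ω, 𝔼 x, f (Function.update ω i x) := by
  have h : 𝔼 p : (ι → X) × X, f (Function.update p.1 i p.2) = 𝔼 p : (ι → X) × X, f p.1 := by
    refine Fintype.expect_equiv
      (Function.Involutive.toPerm (fun p : (ι → X) × X => (Function.update p.1 i p.2, p.1 i)) ?_)
      _ _ fun p => rfl
    intro p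
    simp
  rw [← Finset.univ_product_univ, Finset.expect_product, Finset.expect_product] at h
  rw [h]
  simp

/-- A finite sequence of sign vectors, continued by zero. -/
def signSeq {n T : ℕ} (ω : Fin T → Fin n → Bool) (t : ℕ) : Fin n → ℝ :=
  if h : t < T then signVec (ω ⟨t, h⟩) else 0

theorem expect_potential_deflation_le {n T : ℕ} {D : Matrix (Fin n) (Fin n) ℝ} {s : ℝ}
    (h : NuclearLE D s) {t : ℕ} (ht : t ≤ T) :
    𝔼 ω : Fin T → Fin n → Bool,
      potential s (((deflation (fun j => D *ᵥ signSeq ω j) t * D)ᵀ *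
        (deflation (fun j => D *ᵥ signSeq ω j) t * D)).trace) ≤ (5 / 6) ^ t := by
  induction t with
  | zero =>
    rw [pow_zero]
    refine (Finset.expect_le_expect fun ω _ => potential_le_one s _).trans ?_
    rw [Fintype.expect_const]
  | succ t ih =>
    have ht' : t < T := ht
    rw [expect_update _ (⟨t, ht'⟩ : Fin T)]
    have hstep : ∀ (ω : Fin T → Fin n → Bool) (x : Fin n → Bool),
        deflation (fun j => D *ᵥ signSeq (Function.update ω ⟨t, ht'⟩ x) j) (t + 1) * D =
        deflate (deflation (fun j => D *ᵥ signSeq ω j) t * D)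
          ((deflation (fun j => D *ᵥ signSeq ω j) t * D) *ᵥ signVec x) := by
      intro ω x
      have h1 : deflation (fun j => D *ᵥ signSeq (Function.update ω ⟨t, ht'⟩ x) j) t =
          deflation (fun j => D *ᵥ signSeq ω j) t := by
        refine deflation_congr fun i hi => ?_
        have : i < T := hi.trans ht'
        simp [signSeq, this, hi.ne]
      have h2 : signSeq (Function.update ω ⟨t, ht'⟩ x) t = signVec x := by
        simp [signSeq, ht']
      rw [deflation, h1, h2, deflate_mul, mulVec_mulVec]
    simp only [hstep]
    calc _ ≤ 𝔼 ω : Fin T → Fin n → Bool, 5 / 6 *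
          potential s (((deflation (fun j => D *ᵥ signSeq ω j) t * D)ᵀ *
            (deflation (fun j => D *ᵥ signSeq ω j) t * D)).trace) :=
          Finset.expect_le_expect fun ω _ =>
            expect_potential_deflate_le (h.mul_left (isContraction_deflation _ _))
      _ ≤ 5 / 6 * (5 / 6) ^ t := by
          rw [← Finset.mul_expect]
          exact mul_le_mul_of_nonneg_left (ih ht'.le) (by norm_num)
      _ = _ := by rw [pow_succ]; ring

open Classical in
/-- After `T` adaptive deflations the residual is as small as that of the best approximation of
rank about `k`, up to an exponentially small failure probability. -/
theorem prob_residual_large_le {n T : ℕ} {D : Matrix (Fin n) (Fin n) ℝ} {s k : ℝ}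
    (h : NuclearLE D s) (hs : 0 < s) (hk : 0 < k) :
    𝔼 ω : Fin T → Fin n → Bool,
      (if s ^ 2 / k < ((deflation (fun j => D *ᵥ signSeq ω j) T * D)ᵀ *
        (deflation (fun j => D *ᵥ signSeq ω j) T * D)).trace then (1 : ℝ) else 0) ≤
      Real.exp k * (5 / 6) ^ T := by
  refine le_trans ?_ (mul_le_mul_of_nonneg_left (expect_potential_deflation_le h le_rfl)
    (Real.exp_pos k).le)
  rw [Finset.mul_expect]
  refine Finset.expect_le_expect fun ω _ => ?_
  split_ifs with hlt
  · have hpos : 0 < s ^ 2 / k := by positivity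
    rw [potential, if_neg (not_le.2 (hpos.trans hlt)), ← Real.exp_add]
    refine Real.one_le_exp ?_
    have : s ^ 2 / _ ≤ s ^ 2 / (s ^ 2 / k) :=
      div_le_div_of_nonneg_left (sq_nonneg s) hpos hlt.le
    have h2 : s ^ 2 / (s ^ 2 / k) = k := by field_simp
    linarith
  · exact mul_nonneg (Real.exp_pos k).le (potential_nonneg s _)

/-! ### Medians of means and Hutchinson's estimator -/

/-- The median of a finite family: the largest value attained or exceeded by a strict majority. -/
noncomputable def median {r : ℕ} (x : Fin r → ℝ) : ℝ :=
  ⨆ B : {B : Finset (Fin r) // r < 2 * B.card}, ⨅ i : B.1, x i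

theorem measurable_median {r : ℕ} : Measurable (median (r := r)) :=
  Measurable.iSup fun _ => Measurable.iInf fun i => measurable_pi_apply i.1

open Classical in
theorem abs_median_sub_le {r : ℕ} {x : Fin r → ℝ} {μ η : ℝ} (hr : 0 < r)
    (h : 2 * (Finset.univ.filter fun i => η < |x i - μ|).card < r) : |median x - μ| ≤ η := by
  set good : Finset (Fin r) := Finset.univ.filter fun i => ¬ η < |x i - μ| with hgood
  have hcard : (Finset.univ.filter fun i => η < |x i - μ|).card + good.card = r := by
    rw [hgood, Finset.card_filter_add_card_filter_not]
    simp
  have hg : r < 2 * good.card := by omega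
  have hgm : ∀ i ∈ good, |x i - μ| ≤ η := fun i hi =>
    not_lt.1 (Finset.mem_filter.1 hi).2
  have : Nonempty {B : Finset (Fin r) // r < 2 * B.card} := ⟨⟨good, hg⟩⟩
  have hne : ∀ B : {B : Finset (Fin r) // r < 2 * B.card}, B.1.Nonempty := fun B =>
    Finset.card_pos.1 (by have := B.2; omega)
  rw [abs_le]
  constructor
  · have : Nonempty good := (hne ⟨good, hg⟩).to_subtype
    have h1 : μ - η ≤ ⨅ i : good, x i := le_ciInf fun i => by
      have := abs_le.1 (hgm i i.2)
      linarith
    have h2 := le_ciSup (f := fun B : {B : Finset (Fin r) // r < 2 * B.card} => ⨅ i : B.1, x i)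
      (Set.finite_range _).bddAbove ⟨good, hg⟩
    change _ ≤ median x at h2
    change (⨅ i : good, x i) ≤ _ at h2
    linarith
  · have h1 : median x ≤ μ + η := ciSup_le fun B => by
      -- two majorities intersect
      have hint : (B.1 ∩ good).Nonempty := by
        rw [← Finset.card_pos]
        have h3 := Finset.card_union_add_card_inter B.1 good
        have h4 : (B.1 ∪ good).card ≤ r := by
          simpa using Finset.card_le_univ (B.1 ∪ good)
        have := B.2
        omega
      obtain ⟨i, hi⟩ := hint
      rw [Finset.mem_inter] at hi
      have h5 := ciInf_le (f := fun i : B.1 => x i) (Set.finite_range _).bddBelow ⟨i, hi.1⟩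
      have := abs_le.1 (hgm i hi.2)
      simp only at h5
      linarith
    linarith

open Classical in
/-- If each of `r` independent events has probability at most `1 / 64`, then half of them occur with
probability at most `2⁻ʳ`, by Markov's inequality for `16` to the number of occurrences. -/
theorem prob_majority_le {Y : Type*} [Fintype Y] [Nonempty Y] (r : ℕ) (p : Y → Prop)
    (h : 𝔼 y, (if p y then (1 : ℝ) else 0) ≤ 1 / 64) :
    𝔼 ω : Fin r → Y, (if r ≤ 2 * (Finset.univ.filter fun i => p (ω i)).card
      then (1 : ℝ) else 0) ≤ (1 / 2) ^ r := by
  have hpow : ∀ ω : Fin r → Y, ∏ i, (if p (ω i) then (16 : ℝ) else 1) =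
      16 ^ (Finset.univ.filter fun i => p (ω i)).card := by
    intro ω
    rw [Finset.prod_ite]
    simp
  calc 𝔼 ω : Fin r → Y, (if r ≤ 2 * (Finset.univ.filter fun i => p (ω i)).card
        then (1 : ℝ) else 0)
      ≤ 𝔼 ω : Fin r → Y, (∏ i, (if p (ω i) then (16 : ℝ) else 1)) * (1 / 4) ^ r := by
        refine Finset.expect_le_expect fun ω _ => ?_
        rw [hpow]
        split_ifs with hle
        · have h1 : (4 : ℝ) ^ r ≤ 16 ^ (Finset.univ.filter fun i => p (ω i)).card := by
            rw [show (16 : ℝ) = 4 ^ 2 by norm_num, ← pow_mul]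
            exact pow_le_pow_right₀ (by norm_num) hle
          rw [_root_.one_div_pow, ← div_eq_mul_one_div, le_div_iff₀ (by positivity), one_mul]
          exact h1
        · positivity
    _ = (𝔼 y, (if p y then (16 : ℝ) else 1)) ^ r * (1 / 4) ^ r := by
        rw [← Finset.expect_mul, Finset.expect_pow]
        simp [Fintype.piFinset_univ]
    _ ≤ 2 ^ r * (1 / 4) ^ r := by
        have h16 : ∀ y, (if p y then (16 : ℝ) else 1) = 1 + 15 * (if p y then (1 : ℝ) else 0) := by
          intro y; split_ifs <;> norm_num
        have h2 : 𝔼 y, (if p y then (16 : ℝ) else 1) ≤ 2 := by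
          simp only [h16]
          rw [Finset.expect_add_distrib, Fintype.expect_const, ← Finset.mul_expect]
          linarith
        have h0 : 0 ≤ 𝔼 y, (if p y then (16 : ℝ) else 1) :=
          Finset.expect_nonneg fun y _ => by split_ifs <;> norm_num
        gcongr
    _ = _ := by rw [← mul_pow]; norm_num

theorem expect_fin_succ {X : Type*} [Fintype X] {b : ℕ} (f : (Fin (b + 1) → X) → ℝ) :
    𝔼 z, f z = 𝔼 x : X, 𝔼 y : Fin b → X, f (Fin.cons x y) := by
  have h1 : 𝔼 z, f z = 𝔼 p : X × (Fin b → X), f (Fin.cons p.1 p.2) :=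
    (Fintype.expect_equiv (Fin.consEquiv fun _ => X) _ _ fun p => rfl).symm
  rw [h1, ← Finset.univ_product_univ, Finset.expect_product]

/-- The variances of independent centred variables add up. -/
theorem expect_sum_sq_le {X : Type*} [Fintype X] [Nonempty X] {f : X → ℝ} {v : ℝ}
    (h0 : 𝔼 x, f x = 0) (hv : 𝔼 x, f x ^ 2 ≤ v) (b : ℕ) :
    𝔼 y : Fin b → X, (∑ j, f (y j)) ^ 2 ≤ b * v := by
  induction b with
  | zero => simp
  | succ b ih =>
    rw [expect_fin_succ]
    have h1 : ∀ (x : X) (y : Fin b → X),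
        (∑ j, f ((Fin.cons x y : Fin (b + 1) → X) j)) ^ 2 =
          f x ^ 2 + 2 * f x * (∑ j, f (y j)) + (∑ j, f (y j)) ^ 2 := by
      intro x y
      rw [Fin.sum_univ_succ]
      simp
      ring
    simp only [h1, Finset.expect_add_distrib, Fintype.expect_const, ← Finset.mul_expect,
      ← Finset.expect_mul, h0]
    push_cast
    linarith

theorem expect_hutchinson {n : ℕ} (R : Matrix (Fin n) (Fin n) ℝ) :
    𝔼 x, (signVec x ⬝ᵥ (R *ᵥ signVec x)) = R.trace := by
  have h : ∀ g : Fin n → ℝ, g ⬝ᵥ (R *ᵥ g) = ∑ i, (Pi.single i 1 ⬝ᵥ g) * (R i ⬝ᵥ g) := by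
    intro g
    simp [dotProduct, Matrix.mulVec, Pi.single_apply]
  simp only [h, Finset.expect_sum_comm, expect_sign_mul]
  simp [Matrix.trace]

open Classical in
/-- Chebyshev's inequality for the mean of `b` independent copies of Hutchinson's estimator. -/
theorem prob_hutchinson_mean_le {n b : ℕ} (R : Matrix (Fin n) (Fin n) ℝ) {η : ℝ} (hη : 0 < η)
    (hb : 0 < b) (h : 128 * (Rᵀ * R).trace ≤ b * η ^ 2) :
    𝔼 y : Fin b → Fin n → Bool,
      (if η < |(∑ l, signVec (y l) ⬝ᵥ (R *ᵥ signVec (y l))) / b - R.trace| then (1 : ℝ) else 0) ≤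
      1 / 64 := by
  have hb' : (0 : ℝ) < b := by exact_mod_cast hb
  have h1 := expect_sum_sq_le (f := fun x => signVec x ⬝ᵥ (R *ᵥ signVec x) - R.trace)
    (by rw [Finset.expect_sub_distrib, expect_hutchinson, Fintype.expect_const, sub_self])
    (expect_hutchinson_sq_le R) b
  have h2 : ∀ y : Fin b → Fin n → Bool,
      (if η < |(∑ l, signVec (y l) ⬝ᵥ (R *ᵥ signVec (y l))) / b - R.trace| then (1 : ℝ) else 0) ≤
      1 / (b ^ 2 * η ^ 2) *
        (∑ l, (signVec (y l) ⬝ᵥ (R *ᵥ signVec (y l)) - R.trace)) ^ 2 := by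
    intro y
    split_ifs with hlt
    · rw [Finset.sum_sub_distrib]
      set S := ∑ l, signVec (y l) ⬝ᵥ (R *ᵥ signVec (y l))
      have h3 : S - ∑ _l : Fin b, R.trace = b * (S / b - R.trace) := by
        simp
        field_simp
      rw [h3, mul_pow, ← sq_abs (S / b - R.trace)]
      have h4 : η ^ 2 ≤ |S / b - R.trace| ^ 2 := by gcongr
      rw [one_div, ← div_eq_inv_mul, le_div_iff₀ (by positivity), one_mul]
      gcongr
    · positivity
  refine (Finset.expect_le_expect fun y _ => h2 y).trans ?_
  rw [← Finset.mul_expect]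
  refine (mul_le_mul_of_nonneg_left h1 (by positivity)).trans ?_
  rw [one_div, ← div_eq_inv_mul, div_le_div_iff₀ (by positivity) (by norm_num)]
  nlinarith

/-! ### Trace estimation for a single matrix -/

/-- The parameters of the estimator for the trace of a single matrix: the number of deflations, the
number of groups of random vectors and the size of each group. -/
structure ProbeSize where
  /-- number of deflations -/
  rank : ℕ
  /-- number of groups -/
  groups : ℕ
  /-- number of random vectors in each group -/
  groupSize : ℕ

namespace ProbeSize

variable (p : ProbeSize) {n : ℕ}

/-- The random signs used by the estimator: one vector for each deflation and one for each member
of each group. -/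
abbrev Seed (n : ℕ) : Type :=
  (Fin p.rank → Fin n → Bool) × (Fin p.groups → Fin p.groupSize → Fin n → Bool)

/-- Two products for each deflation, one for each random vector in the groups. -/
def numQueries : ℕ := 2 * p.rank + p.groups * p.groupSize

/-- The `e`-th query vector, as a function of the seed and of the earlier answers `d`: first the
random vectors of the deflations, then the directions which get deflated, then the random vectors of
the groups. -/
noncomputable def vector (ω : p.Seed n) (d : ℕ → Fin n → ℝ) (e : ℕ) : Fin n → ℝ :=
  if e < p.rank then signSeq ω.1 e
  else if e < 2 * p.rank then deflation d (e - p.rank) *ᵥ d (e - p.rank)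
  else if h : e - 2 * p.rank < p.groups * p.groupSize then
    signVec (ω.2 (finProdFinEquiv.symm ⟨_, h⟩).1 (finProdFinEquiv.symm ⟨_, h⟩).2)
  else 0

/-- The estimate computed from the answers `d`: the exact trace of the deflated part, plus the
median over the groups of the means of Hutchinson's estimator for the residual. -/
noncomputable def estimate (ω : p.Seed n) (d : ℕ → Fin n → ℝ) : ℝ :=
  ∑ t ∈ Finset.range p.rank,
      ((deflation d t *ᵥ d t) ⬝ᵥ (deflation d t *ᵥ d t))⁻¹ *
        (((deflation d t *ᵥ d t) ᵥ* deflation d t) ⬝ᵥ d (p.rank + t)) +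
    median fun j => (∑ l, signVec (ω.2 j l) ⬝ᵥ
      (deflation d p.rank *ᵥ d (2 * p.rank + finProdFinEquiv (j, l)))) / p.groupSize

theorem vector_congr (ω : p.Seed n) {d d' : ℕ → Fin n → ℝ} {e : ℕ} (h : ∀ i < e, d i = d' i) :
    p.vector ω d e = p.vector ω d' e := by
  unfold vector
  split_ifs with h1 h2 h3
  · rfl
  · rw [h (e - p.rank) (by omega), deflation_congr fun i hi => h i (by omega)]
  · rfl
  · rfl

theorem estimate_congr (ω : p.Seed n) {d d' : ℕ → Fin n → ℝ}
    (h : ∀ i < p.numQueries, d i = d' i) : p.estimate ω d = p.estimate ω d' := by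
  unfold numQueries at h
  unfold estimate
  congr 1
  · refine Finset.sum_congr rfl fun t ht => ?_
    rw [Finset.mem_range] at ht
    rw [h t (by omega), h (p.rank + t) (by omega), deflation_congr fun i hi => h i (by omega)]
  · congr 1
    ext j
    congr 1
    refine Finset.sum_congr rfl fun l _ => ?_
    have := (finProdFinEquiv (j, l)).2
    rw [h _ (by omega), deflation_congr fun i hi => h i (by omega)]

theorem _root_.measurable_deflation_apply (t : ℕ) (i j : Fin n) :
    Measurable fun d : ℕ → Fin n → ℝ => deflation d t i j := by
  induction t generalizing i j with
  | zero => exact measurable_const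
  | succ t ih =>
    simp only [deflation, deflate, Matrix.sub_apply, Matrix.smul_apply, vecMulVec_apply,
      Matrix.mulVec, Matrix.vecMul, dotProduct, smul_eq_mul]
    fun_prop

theorem measurable_vector (ω : p.Seed n) (e : ℕ) : Measurable fun d => p.vector ω d e := by
  unfold vector
  split_ifs
  · exact measurable_const
  · refine measurable_pi_lambda _ fun i => ?_
    have := fun j => measurable_deflation_apply (n := n) (e - p.rank) i j
    simp only [Matrix.mulVec, dotProduct]
    fun_prop
  · exact measurable_const
  · exact measurable_const

theorem measurable_estimate (ω : p.Seed n) : Measurable (p.estimate ω) := by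
  unfold estimate
  have hd := fun t i j => measurable_deflation_apply (n := n) t i j
  refine Measurable.add ?_ (measurable_median.comp (measurable_pi_lambda _ fun j => ?_))
  · simp only [Matrix.mulVec, Matrix.vecMul, dotProduct]
    fun_prop
  · simp only [Matrix.mulVec, dotProduct]
    fun_prop

/-- `d` lists the answers of the estimator with seed `ω` for the matrix `D`. -/
def IsAnswer (D : Matrix (Fin n) (Fin n) ℝ) (ω : p.Seed n) (d : ℕ → Fin n → ℝ) : Prop :=
  ∀ e < p.numQueries, d e = D *ᵥ p.vector ω d e

theorem IsAnswer.deflation_eq {p : ProbeSize} {D : Matrix (Fin n) (Fin n) ℝ} {ω : p.Seed n}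
    {d : ℕ → Fin n → ℝ} (h : p.IsAnswer D ω d) {t : ℕ} (ht : t ≤ p.rank) :
    deflation d t = deflation (fun j => D *ᵥ signSeq ω.1 j) t := by
  refine deflation_congr fun i hi => ?_
  have hi' : i < p.rank := hi.trans_le ht
  rw [h i (by unfold numQueries; omega), vector, if_pos hi']

theorem IsAnswer.estimate_eq {p : ProbeSize} {D : Matrix (Fin n) (Fin n) ℝ} {ω : p.Seed n}
    {d : ℕ → Fin n → ℝ} (h : p.IsAnswer D ω d) :
    p.estimate ω d - D.trace =
      (median fun j => (∑ l, signVec (ω.2 j l) ⬝ᵥ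
        ((deflation (fun j => D *ᵥ signSeq ω.1 j) p.rank * D) *ᵥ signVec (ω.2 j l))) /
          p.groupSize) - (deflation (fun j => D *ᵥ signSeq ω.1 j) p.rank * D).trace := by
  have h1 : ∀ t ∈ Finset.range p.rank, ((deflation d t *ᵥ d t) ⬝ᵥ (deflation d t *ᵥ d t))⁻¹ *
        (((deflation d t *ᵥ d t) ᵥ* deflation d t) ⬝ᵥ d (p.rank + t)) =
      ((deflation d t *ᵥ d t) ⬝ᵥ (deflation d t *ᵥ d t))⁻¹ *
        (((deflation d t *ᵥ d t) ᵥ* deflation d t) ⬝ᵥ (D *ᵥ (deflation d t *ᵥ d t))) := by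
    intro t ht
    rw [Finset.mem_range] at ht
    rw [h (p.rank + t) (by unfold numQueries; omega), vector, if_neg (by omega),
      if_pos (by omega), Nat.add_sub_cancel_left]
  have h2 : ∀ j l, d (2 * p.rank + finProdFinEquiv (j, l)) = D *ᵥ signVec (ω.2 j l) := by
    intro j l
    have hlt := (finProdFinEquiv (j, l)).2
    have h3 : 2 * p.rank + (finProdFinEquiv (j, l) : ℕ) - 2 * p.rank =
      (finProdFinEquiv (j, l) : ℕ) := Nat.add_sub_cancel_left _ _
    rw [h _ (by unfold numQueries; omega), vector, if_neg (by omega), if_neg (by omega),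
      dif_pos (by omega)]
    simp only [h3, Fin.eta, Equiv.symm_apply_apply]
  rw [estimate, Finset.sum_congr rfl h1, trace_eq_sum_add_trace_deflation D d p.rank]
  simp only [h2, mulVec_mulVec, h.deflation_eq le_rfl]
  ring

open Classical in
/-- The failure probability of the estimator for a single matrix. -/
theorem prob_error_le {D : Matrix (Fin n) (Fin n) ℝ} {s k η : ℝ} (hD : NuclearLE D s) (hs : 0 < s)
    (hk : 0 < k) (hη : 0 < η) (hg : 0 < p.groups) (hb : 0 < p.groupSize)
    (hbk : 128 * (s ^ 2 / k) ≤ p.groupSize * η ^ 2) :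
    𝔼 ω : p.Seed n, (if ∃ d, p.IsAnswer D ω d ∧ η < |p.estimate ω d - D.trace|
      then (1 : ℝ) else 0) ≤ Real.exp k * (5 / 6) ^ p.rank + (1 / 2) ^ p.groups := by
  set R : (Fin p.rank → Fin n → Bool) → Matrix (Fin n) (Fin n) ℝ := fun ω =>
    deflation (fun j => D *ᵥ signSeq ω j) p.rank * D with hR
  set bad : (Fin p.rank → Fin n → Bool) → (Fin p.groupSize → Fin n → Bool) → Prop := fun ω y =>
    η < |(∑ l, signVec (y l) ⬝ᵥ (R ω *ᵥ signVec (y l))) / p.groupSize - (R ω).trace| with hbad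
  have hpt : ∀ ω : p.Seed n, (if ∃ d, p.IsAnswer D ω d ∧ η < |p.estimate ω d - D.trace|
      then (1 : ℝ) else 0) ≤
      (if s ^ 2 / k < ((R ω.1)ᵀ * R ω.1).trace then (1 : ℝ) else 0) +
      if ((R ω.1)ᵀ * R ω.1).trace ≤ s ^ 2 / k then
        (if p.groups ≤ 2 * (Finset.univ.filter fun j => bad ω.1 (ω.2 j)).card then (1 : ℝ) else 0)
      else 0 := by
    intro ω
    by_cases hlt : s ^ 2 / k < ((R ω.1)ᵀ * R ω.1).trace
    · rw [if_pos hlt, if_neg (not_le.2 hlt)]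
      split_ifs <;> norm_num
    · rw [if_neg hlt, if_pos (not_lt.1 hlt), zero_add]
      by_cases hmaj : p.groups ≤ 2 * (Finset.univ.filter fun j => bad ω.1 (ω.2 j)).card
      · rw [if_pos hmaj]
        split_ifs <;> norm_num
      · rw [if_neg hmaj, if_neg]
        rintro ⟨d, hd, herr⟩
        rw [hd.estimate_eq] at herr
        exact absurd herr (not_lt.2 (abs_median_sub_le hg (not_le.1 hmaj)))
  refine (Finset.expect_le_expect fun ω _ => hpt ω).trans ?_
  rw [Finset.expect_add_distrib, ← Finset.univ_product_univ, Finset.expect_product,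
    Finset.expect_product]
  refine add_le_add ?_ ?_
  · exact le_of_eq_of_le (Finset.expect_congr rfl fun ω _ => Fintype.expect_const
        (if s ^ 2 / k < ((R ω)ᵀ * R ω).trace then (1 : ℝ) else 0))
      (prob_residual_large_le hD hs hk)
  · refine (Finset.expect_le_expect (g := fun _ => ((1 : ℝ) / 2) ^ p.groups)
      fun ω _ => ?_).trans (Fintype.expect_const _).le
    by_cases hle : ((R ω)ᵀ * R ω).trace ≤ s ^ 2 / k
    · simp only [if_pos hle]
      exact prob_majority_le p.groups (bad ω)
        (prob_hutchinson_mean_le (R ω) hη hb (le_trans (by linarith) hbk))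
    · simp only [if_neg hle]
      rw [Fintype.expect_const]
      positivity

end ProbeSize

open Classical in
/-- The trace of a matrix of nuclear norm at most `s` can be estimated within `η`, with failure
probability `2 * 2⁻ˡ`, from `O(s √l / η + l)` matrix-vector products. -/
theorem exists_probeSize {s η : ℝ} (hs : 0 < s) (hη : 0 < η) {l : ℕ} (hl : 0 < l) :
    ∃ p : ProbeSize, (p.numQueries : ℝ) ≤ 140 * (s * √l / η) + 25 * l ∧
      ∀ (n : ℕ) (D : Matrix (Fin n) (Fin n) ℝ), NuclearLE D s →
        𝔼 ω : p.Seed n, (if ∃ d, p.IsAnswer D ω d ∧ η < |p.estimate ω d - D.trace|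
          then (1 : ℝ) else 0) ≤ 2 * (1 / 2) ^ l := by
  have hl' : (1 : ℝ) ≤ l := by exact_mod_cast hl
  have hsq : √(l : ℝ) * √l = l := Real.mul_self_sqrt (by positivity)
  have hsq0 : 0 < √(l : ℝ) := Real.sqrt_pos.2 (by positivity)
  set z := s * √l / η with hz
  have hz0 : 0 < z := by positivity
  -- `k` balances the number of deflations, `O(k + l)`, and of random vectors, `O(l + s² l / (k η²))`
  set k := ⌈z⌉₊ with hk
  have hkz : z ≤ k := Nat.le_ceil z
  have hkz' : (k : ℝ) < z + 1 := Nat.ceil_lt_add_one hz0.le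
  have hk0 : (0 : ℝ) < k := hz0.trans_le hkz
  set q := 128 * (s ^ 2 / k) / η ^ 2 with hq
  have hq0 : 0 < q := by positivity
  set b := ⌈q⌉₊ with hb
  have hbq : q ≤ b := Nat.le_ceil q
  have hbq' : (b : ℝ) < q + 1 := Nat.ceil_lt_add_one hq0.le
  have hlq : l * q ≤ 128 * z := by
    have h1 : q ≤ 128 * (s ^ 2 / z) / η ^ 2 := by rw [hq]; gcongr
    have h2 : l * (128 * (s ^ 2 / z) / η ^ 2) = 128 * z := by
      rw [← hsq, hz]
      field_simp
    rw [← h2]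
    gcongr
  refine ⟨⟨6 * (k + l), l, b⟩, ?_, fun n D hD => ?_⟩
  · simp only [ProbeSize.numQueries]
    push_cast
    nlinarith
  · refine (ProbeSize.prob_error_le _ hD hs hk0 hη hl (Nat.ceil_pos.2 hq0) ?_).trans ?_
    · have : q * η ^ 2 = 128 * (s ^ 2 / k) := by rw [hq]; field_simp
      rw [← this]
      gcongr
    · simp only
      have h1 : Real.exp k * (5 / 6 : ℝ) ^ (6 * (k + l)) ≤ (1 / 2) ^ l := by
        have h2 : (5 / 6 : ℝ) ^ 6 ≤ Real.exp (-1) := by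
          have h3 : (5 / 6 : ℝ) ≤ Real.exp (-(1 / 6)) := by
            have := Real.one_sub_le_exp_neg (1 / 6)
            norm_num at this ⊢
            exact this
          calc (5 / 6 : ℝ) ^ 6 ≤ Real.exp (-(1 / 6)) ^ 6 := by gcongr
            _ = _ := by rw [← Real.exp_nat_mul]; norm_num
        have h4 : Real.exp (-1) ≤ 1 / 2 := by
          rw [Real.exp_neg, one_div]
          refine inv_anti₀ (by norm_num) ?_
          have := Real.add_one_le_exp (1 : ℝ)
          linarith
        calc Real.exp k * (5 / 6 : ℝ) ^ (6 * (k + l))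
            ≤ Real.exp k * Real.exp (-1) ^ (k + l) := by
              rw [pow_mul]; gcongr
          _ = Real.exp (-1) ^ l := by
              rw [pow_add, ← mul_assoc, ← Real.exp_nat_mul, ← Real.exp_add]
              simp
          _ ≤ _ := by gcongr
      linarith

/-! ### Online algorithms built from stages -/

namespace OnlineMatVecAlgorithm

variable {n m : ℕ} (alg : OnlineMatVecAlgorithm n m)

theorem answers_apply (A : Fin m → Matrix (Fin n) (Fin n) ℝ) (ω : alg.Ω) (k : ℕ) (l : Fin k) :
    alg.answers A ω k l = A (alg.target l ω (alg.answers A ω l)) *ᵥ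
      alg.vector l ω (alg.answers A ω l) := by
  induction k with
  | zero => exact l.elim0
  | succ k ih =>
    refine Fin.lastCases ?_ (fun l => ?_) l
    · rw [answers, Fin.snoc_last]
      rfl
    · rw [answers, Fin.snoc_castSucc, ih]
      rfl

end OnlineMatVecAlgorithm

/-- An online algorithm split into stages, one for each matrix of the stream. The queries of a stage
depend on the seed and on the earlier answers of that stage only; the `i`-th estimate depends on all
answers of the stages up to `i`. -/
structure StagedAlgorithm (n m : ℕ) (Ω : Type) where
  /-- number of queries of each stage -/
  len : ℕ → ℕ
  /-- index of the matrix to which the `e`-th query of stage `i` goes -/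
  target : Fin m → ℕ → Fin m
  /-- vector of the `e`-th query of stage `i` -/
  vector : Fin m → ℕ → Ω → (ℕ → Fin n → ℝ) → Fin n → ℝ
  /-- the `i`-th estimate, computed from the answers `a j e` to the `e`-th query of stage `j` -/
  estimate : Fin m → Ω → (ℕ → ℕ → Fin n → ℝ) → ℝ
  target_le : ∀ i e, target i e ≤ i
  vector_congr : ∀ i e ω d d', (∀ l < e, d l = d' l) → vector i e ω d = vector i e ω d'
  estimate_congr : ∀ (i : Fin m) ω a a', (∀ j ≤ (i : ℕ), ∀ e < len j, a j e = a' j e) →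
    estimate i ω a = estimate i ω a'
  measurable_vector : ∀ i e ω, Measurable (vector i e ω)
  measurable_estimate : ∀ i ω, Measurable (estimate i ω)

namespace StagedAlgorithm

variable {n m : ℕ} {Ω : Type} (S : StagedAlgorithm n m Ω)

/-- Number of queries made before stage `i`. -/
def offset (i : ℕ) : ℕ := ∑ j ∈ Finset.range i, S.len j

theorem offset_mono : Monotone S.offset := fun _ _ h =>
  Finset.sum_le_sum_of_subset (Finset.range_subset_range.2 h)

theorem offset_succ (i : ℕ) : S.offset (i + 1) = S.offset i + S.len i := Finset.sum_range_succ _ _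

/-- The stage to which the `k`-th query belongs. -/
def stage [NeZero m] (k : ℕ) : Fin m :=
  ⟨Nat.findGreatest (fun i => S.offset i ≤ k) (m - 1),
    (Nat.findGreatest_le _).trans_lt (Nat.sub_lt (NeZero.pos m) one_pos)⟩

theorem offset_stage_le [NeZero m] (k : ℕ) : S.offset (S.stage (m := m) k) ≤ k :=
  Nat.findGreatest_spec (P := fun i => S.offset i ≤ k) (Nat.zero_le (m - 1)) (by simp [offset])

theorem stage_le [NeZero m] {i k : ℕ} (h : k < S.offset (i + 1)) : (S.stage (m := m) k : ℕ) ≤ i := by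
  by_contra hlt
  exact absurd (S.offset_stage_le k) (not_le.2 (h.trans_le (S.offset_mono (not_le.1 hlt))))

theorem stage_offset_add [NeZero m] (j : Fin m) {e : ℕ} (he : e < S.len j) :
    S.stage (S.offset j + e) = j := by
  refine Fin.ext (le_antisymm (S.stage_le ?_) ?_)
  · rw [offset_succ]; omega
  · exact Nat.le_findGreatest (by have := j.2; omega) (Nat.le_add_right _ _)

/-- A finite history, continued by zero. -/
def _root_.padHistory {k : ℕ} (h : Fin k → Fin n → ℝ) (l : ℕ) : Fin n → ℝ :=
  if hl : l < k then h ⟨l, hl⟩ else 0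

theorem _root_.measurable_padHistory {k : ℕ} (l : ℕ) :
    Measurable fun h : Fin k → Fin n → ℝ => padHistory h l := by
  unfold padHistory
  split_ifs
  · exact measurable_pi_apply _
  · exact measurable_const

/-- The stages run one after the other. -/
noncomputable def toOnline [NeZero m] [MeasurableSpace Ω] [Countable Ω]
    [MeasurableSingletonClass Ω] (P : Measure Ω) [IsProbabilityMeasure P] :
    OnlineMatVecAlgorithm n m where
  Ω := Ω
  P := P
  target k _ _ := S.target (S.stage k) (k - S.offset (S.stage (m := m) k))
  vector k ω h := S.vector (S.stage k) (k - S.offset (S.stage (m := m) k)) ω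
    fun e => padHistory h (S.offset (S.stage (m := m) k) + e)
  queriesBefore i := S.offset (i + 1)
  estimate i ω h := S.estimate i ω fun j e => padHistory h (S.offset j + e)
  measurable_target _ := measurable_const
  measurable_vector _ := measurable_from_prod_countable_right fun ω =>
    (S.measurable_vector _ _ ω).comp (measurable_pi_lambda _ fun _ => measurable_padHistory _)
  measurable_estimate i := measurable_from_prod_countable_right fun ω =>
    (S.measurable_estimate i ω).comp (measurable_pi_lambda _ fun _ =>
      measurable_pi_lambda _ fun _ => measurable_padHistory _)
  monotone_queriesBefore := fun _ _ h => S.offset_mono (Nat.succ_le_succ h)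
  online _ _ hk _ _ := (S.target_le _ _).trans (S.stage_le hk)

section

variable [NeZero m] [MeasurableSpace Ω] [Countable Ω] [MeasurableSingletonClass Ω] (P : Measure Ω)
  [IsProbabilityMeasure P]

theorem totalQueries_toOnline_le :
    (S.toOnline P).totalQueries ≤ ∑ j ∈ Finset.range m, S.len j :=
  Finset.sup_le fun i _ => S.offset_mono i.2

/-- Running the stages one after the other answers the queries of each stage. -/
theorem exists_output_toOnline_eq (A : Fin m → Matrix (Fin n) (Fin n) ℝ) (ω : Ω) :
    ∃ a : ℕ → ℕ → Fin n → ℝ,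
      (∀ (j : Fin m), ∀ e < S.len j, a j e = A (S.target j e) *ᵥ S.vector j e ω (a j)) ∧
      ∀ i, (S.toOnline P).output A i ω = S.estimate i ω a := by
  set alg := S.toOnline P with halg
  set ans : ℕ → Fin n → ℝ := fun k => A (alg.target k ω (alg.answers A ω k)) *ᵥ
    alg.vector k ω (alg.answers A ω k) with hans
  have hpad : ∀ k l, l < k → padHistory (alg.answers A ω k) l = ans l := by
    intro k l hl
    rw [padHistory, dif_pos hl]
    exact alg.answers_apply A ω k ⟨l, hl⟩
  refine ⟨fun j e => ans (S.offset j + e), fun j e he => ?_, fun i => ?_⟩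
  · have h1 : ∀ k, ans k = A (S.target (S.stage k) (k - S.offset (S.stage (m := m) k))) *ᵥ
        S.vector (S.stage k) (k - S.offset (S.stage (m := m) k)) ω
          fun e => padHistory (alg.answers A ω k) (S.offset (S.stage (m := m) k) + e) := fun k => rfl
    refine (h1 _).trans ?_
    rw [S.stage_offset_add j he, Nat.add_sub_cancel_left]
    congr 1
    exact S.vector_congr _ _ _ _ _ fun l hl => hpad _ _ (by omega)
  · refine S.estimate_congr _ _ _ _ fun j hj e he => hpad _ _ ?_
    have h1 := S.offset_mono (Nat.succ_le_succ hj)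
    have h2 := S.offset_succ j
    change _ < S.offset (i + 1)
    simp only [Nat.succ_eq_add_one] at h1
    omega

end

end StagedAlgorithm

/-! ### Estimation along chains of increments -/

open Classical in
theorem uniformOn_univ_real_eq_expect {Y : Type*} [Fintype Y] [MeasurableSpace Y]
    [MeasurableSingletonClass Y] (p : Y → Prop) :
    (ProbabilityTheory.uniformOn (Set.univ : Set Y)).real {y | p y} =
      𝔼 y, (if p y then (1 : ℝ) else 0) := by
  rw [measureReal_def, ProbabilityTheory.uniformOn_univ, Fintype.expect_eq_sum_div_card,
    Measure.count_apply_finite _ (Set.toFinite _), ENNReal.toReal_div]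
  simp

/-- A scheme which estimates the trace of each matrix of the stream as a sum of traces of increments
along a chain of earlier matrices. Every active matrix `A j` carries the increment
`A j - coeff j • A (parent j)`, whose trace is estimated once, with an estimator that depends on the
level of `j` only. All matrices of the same level share one seed. -/
structure ChainScheme (m : ℕ) where
  /-- the levels are `0, …, top` -/
  top : ℕ
  /-- the estimator used at each level -/
  size : Fin (top + 1) → ProbeSize
  /-- the level of each time -/
  level : ℕ → Fin (top + 1)
  /-- the times at which queries are made -/
  active : Set ℕ
  /-- the earlier time to which a time is compared -/
  parent : Fin m → Fin m
  parent_le : ∀ j, parent j ≤ j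
  /-- the coefficient of the earlier matrix in the increment: `0` makes the increment the matrix
  itself -/
  coeff : Fin m → ℝ
  /-- indices of the links of the chain which leads to a time -/
  links : Fin m → Finset ℕ
  /-- the times on the chain -/
  node : Fin m → ℕ → Fin m
  node_le : ∀ i, ∀ l ∈ links i, node i l ≤ i
  node_active : ∀ i, ∀ l ∈ links i, (node i l : ℕ) ∈ active

namespace ChainScheme

variable {n m : ℕ} (C : ChainScheme m)

/-- The increment carried by a time. -/
def increment (A : Fin m → Matrix (Fin n) (Fin n) ℝ) (j : Fin m) : Matrix (Fin n) (Fin n) ℝ :=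
  A j - C.coeff j • A (C.parent j)

/-- One independent seed for each level. -/
abbrev Seed (n : ℕ) : Type := (l : Fin (C.top + 1)) → (C.size l).Seed n

/-- The products with the increment of `j`, from the answers `d` of the stage `j`, in which the
products with `A j` and `A (parent j)` alternate. -/
def incrementAnswers (j : Fin m) (d : ℕ → Fin n → ℝ) (e : ℕ) : Fin n → ℝ :=
  d (2 * e) - C.coeff j • d (2 * e + 1)

theorem measurable_incrementAnswers (j : Fin m) :
    Measurable (C.incrementAnswers (n := n) j) := by
  unfold incrementAnswers
  fun_prop

open Classical in
/-- The queries made by a chain scheme. -/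
noncomputable def staged (n : ℕ) : StagedAlgorithm n m (C.Seed n) where
  len j := if j ∈ C.active then 2 * (C.size (C.level j)).numQueries else 0
  target j e := if e % 2 = 0 then j else C.parent j
  vector j e ω d := (C.size (C.level j)).vector (ω (C.level j)) (C.incrementAnswers j d) (e / 2)
  estimate i ω a := ∑ l ∈ C.links i, (C.size (C.level (C.node i l))).estimate
    (ω (C.level (C.node i l))) (C.incrementAnswers (C.node i l) (a (C.node i l)))
  target_le j e := by
    split_ifs
    · exact le_rfl
    · exact C.parent_le j
  vector_congr j e ω d d' h := by
    refine ProbeSize.vector_congr _ _ fun i hi => ?_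
    rw [incrementAnswers, incrementAnswers, h _ (by omega), h _ (by omega)]
  estimate_congr i ω a a' h := by
    refine Finset.sum_congr rfl fun l hl => ProbeSize.estimate_congr _ _ fun e he => ?_
    have h1 := h (C.node i l) (C.node_le i l hl)
    rw [if_pos (C.node_active i l hl)] at h1
    rw [incrementAnswers, incrementAnswers, h1 _ (by omega), h1 _ (by omega)]
  measurable_vector j e ω := (ProbeSize.measurable_vector _ _ _).comp
    (C.measurable_incrementAnswers j)
  measurable_estimate i ω := by
    refine Finset.measurable_sum _ fun l _ => (ProbeSize.measurable_estimate _ _).comp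
      ((C.measurable_incrementAnswers _).comp (measurable_pi_apply _))

/-- The law of the seeds: independent uniform signs. -/
noncomputable def seedLaw (n : ℕ) : Measure (C.Seed n) :=
  Measure.pi fun _ => ProbabilityTheory.uniformOn Set.univ

instance : IsProbabilityMeasure (C.seedLaw n) := by
  unfold seedLaw; infer_instance

/-- The online algorithm of a chain scheme. -/
noncomputable def toOnline [NeZero m] (n : ℕ) : OnlineMatVecAlgorithm n m :=
  (C.staged n).toOnline (C.seedLaw n)

open Classical in
theorem totalQueries_toOnline_le [NeZero m] (n : ℕ) : (C.toOnline n).totalQueries ≤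
    ∑ j ∈ Finset.range m, if j ∈ C.active then 2 * (C.size (C.level j)).numQueries else 0 :=
  (C.staged n).totalQueries_toOnline_le _

open Classical in
/-- A union bound over the links of the chain. -/
theorem prob_toOnline_ge [NeZero m] (A : Fin m → Matrix (Fin n) (Fin n) ℝ) (i : Fin m) {η q : ℝ}
    (h : ∀ l ∈ C.links i, 𝔼 ω : (C.size (C.level (C.node i l))).Seed n,
      (if ∃ d, (C.size (C.level (C.node i l))).IsAnswer (C.increment A (C.node i l)) ω d ∧
          η < |(C.size (C.level (C.node i l))).estimate ω d - (C.increment A (C.node i l)).trace|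
        then (1 : ℝ) else 0) ≤ q) :
    1 - (C.links i).card * q ≤ (C.toOnline n).P.real
      {ω | |(C.toOnline n).output A i ω - ∑ l ∈ C.links i, (C.increment A (C.node i l)).trace| ≤
        (C.links i).card * η} := by
  set bad : ℕ → Set (C.Seed n) := fun l => {ω | ∃ d, (C.size (C.level (C.node i l))).IsAnswer
    (C.increment A (C.node i l)) (ω (C.level (C.node i l))) d ∧
      η < |(C.size (C.level (C.node i l))).estimate (ω (C.level (C.node i l))) d -
        (C.increment A (C.node i l)).trace|} with hbad
  have hprob : ∀ l ∈ C.links i, (C.seedLaw n).real (bad l) ≤ q := by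
    intro l hl
    refine le_trans (le_of_eq ?_) (h l hl)
    rw [← uniformOn_univ_real_eq_expect]
    exact (measurePreserving_eval (fun l => ProbabilityTheory.uniformOn
      (Set.univ : Set ((C.size l).Seed n))) (C.level (C.node i l))).measureReal_preimage
        (s := {ω | ∃ d, (C.size (C.level (C.node i l))).IsAnswer (C.increment A (C.node i l)) ω d ∧
          η < |(C.size (C.level (C.node i l))).estimate ω d - (C.increment A (C.node i l)).trace|})
        MeasurableSet.of_discrete.nullMeasurableSet
  have hunion : (C.seedLaw n).real (⋃ l ∈ C.links i, bad l) ≤ (C.links i).card * q := by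
    refine (measureReal_biUnion_finset_le _ _).trans ?_
    rw [← nsmul_eq_mul]
    exact Finset.sum_le_card_nsmul _ _ _ hprob
  have hcover : (Set.univ : Set (C.Seed n)) ⊆ (⋃ l ∈ C.links i, bad l) ∪
      {ω | |(C.toOnline n).output A i ω - ∑ l ∈ C.links i, (C.increment A (C.node i l)).trace| ≤
        (C.links i).card * η} := by
    intro ω _
    by_cases hω : ω ∈ ⋃ l ∈ C.links i, bad l
    · exact Or.inl hω
    · refine Or.inr ?_
      obtain ⟨a, ha, hout⟩ := (C.staged n).exists_output_toOnline_eq (C.seedLaw n) A ω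
      have hgood : ∀ l ∈ C.links i, |(C.size (C.level (C.node i l))).estimate
          (ω (C.level (C.node i l))) (C.incrementAnswers (C.node i l) (a (C.node i l))) -
            (C.increment A (C.node i l)).trace| ≤ η := by
        intro l hl
        by_contra hlt
        refine hω (Set.mem_biUnion hl ⟨_, fun e he => ?_, not_le.1 hlt⟩)
        set j := C.node i l
        have hlen : (C.staged n).len j = 2 * (C.size (C.level j)).numQueries :=
          if_pos (C.node_active i l hl)
        have h0 := ha j (2 * e) (by omega)
        have h1 := ha j (2 * e + 1) (by omega)
        have e0 : 2 * e / 2 = e := by omega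
        have e1 : (2 * e + 1) / 2 = e := by omega
        have m1 : (2 * e + 1) % 2 ≠ 0 := by omega
        simp only [staged, Nat.mul_mod_right, if_true, e0] at h0
        simp only [staged, if_neg m1, e1] at h1
        rw [incrementAnswers, h0, h1, increment, sub_mulVec, smul_mulVec]
      change |(C.toOnline n).output A i ω - _| ≤ _
      rw [show (C.toOnline n).output A i ω = _ from hout i]
      simp only [staged]
      rw [← Finset.sum_sub_distrib, ← nsmul_eq_mul]
      exact (Finset.abs_sum_le_sum_abs _ _).trans (Finset.sum_le_card_nsmul _ _ _ hgood)
  have h1 : (1 : ℝ) ≤ (C.seedLaw n).real (⋃ l ∈ C.links i, bad l) + (C.seedLaw n).real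
      {ω | |(C.toOnline n).output A i ω - ∑ l ∈ C.links i, (C.increment A (C.node i l)).trace| ≤
        (C.links i).card * η} := by
    rw [← probReal_univ (μ := C.seedLaw n)]
    exact (measureReal_mono hcover).trans (measureReal_union_le _ _)
  exact (sub_le_sub_left hunion 1).trans (sub_le_iff_le_add'.2 h1)

end ChainScheme

/-! ### The dyadic chain scheme -/

/-- The time `i`, rounded down to a multiple of `w * 2 ^ l`. -/
def truncTime (w i l : ℕ) : ℕ := w * (i / w / 2 ^ l * 2 ^ l)

theorem truncTime_le (w i l : ℕ) : truncTime w i l ≤ i :=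
  (Nat.mul_le_mul_left w (Nat.div_mul_le_self _ _)).trans (Nat.mul_div_le i w)

/-- The largest `l ≤ K` such that `w * 2 ^ l` divides the multiple `i` of `w`. -/
def dyadicLevel (w K i : ℕ) : ℕ := Nat.findGreatest (fun l => 2 ^ l ∣ i / w) K

theorem dyadicLevel_le (w K i : ℕ) : dyadicLevel w K i ≤ K := Nat.findGreatest_le _

theorem dvd_of_dyadicLevel {w i : ℕ} (K : ℕ) (hi : w ∣ i) :
    w * 2 ^ dyadicLevel w K i ∣ i := by
  have h : 2 ^ dyadicLevel w K i ∣ i / w :=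
    Nat.findGreatest_spec (P := fun l => 2 ^ l ∣ i / w) (Nat.zero_le K) (by simp)
  have := mul_dvd_mul_left w h
  rwa [Nat.mul_div_cancel' hi] at this

theorem dyadicLevel_zero (w K : ℕ) : dyadicLevel w K 0 = K :=
  Nat.findGreatest_eq (P := fun l => 2 ^ l ∣ 0 / w) (by simp)

theorem div_pow_succ_mul (u l : ℕ) : u / 2 ^ (l + 1) * 2 ^ (l + 1) = u / 2 ^ l / 2 * 2 * 2 ^ l := by
  rw [pow_succ, Nat.div_div_eq_div_mul]
  ring

theorem dyadicLevel_truncTime {w K i l : ℕ} (hw : 0 < w) (hl : l < K)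
    (h : truncTime w i l ≠ truncTime w i (l + 1)) : dyadicLevel w K (truncTime w i l) = l := by
  rw [dyadicLevel, truncTime, Nat.mul_div_cancel_left _ hw, Nat.findGreatest_eq_iff]
  refine ⟨hl.le, fun _ => dvd_mul_left _ _, fun x hx _ hdvd => h ?_⟩
  have h1 : 2 * 2 ^ l ∣ i / w / 2 ^ l * 2 ^ l := by
    rw [← pow_succ']
    exact (pow_dvd_pow 2 hx).trans hdvd
  have h2 : 2 ∣ i / w / 2 ^ l := Nat.dvd_of_mul_dvd_mul_right (by positivity) h1
  rw [truncTime, truncTime, div_pow_succ_mul, Nat.div_mul_cancel h2]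

theorem dyadicLevel_truncTime_top {w : ℕ} (K i : ℕ) (hw : 0 < w) :
    dyadicLevel w K (truncTime w i K) = K := by
  rw [dyadicLevel, truncTime, Nat.mul_div_cancel_left _ hw]
  exact Nat.findGreatest_eq (P := fun l => 2 ^ l ∣ i / w / 2 ^ K * 2 ^ K) (dvd_mul_left _ _)

theorem truncTime_sub {w i l : ℕ} (h : truncTime w i l ≠ truncTime w i (l + 1)) :
    truncTime w i l - w * 2 ^ l = truncTime w i (l + 1) := by
  have h2 : i / w / 2 ^ l % 2 = 1 := by
    by_contra h2
    refine h ?_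
    have h3 : i / w / 2 ^ l / 2 * 2 = i / w / 2 ^ l := by omega
    rw [truncTime, truncTime, div_pow_succ_mul, h3]
  have h3 : i / w / 2 ^ l / 2 * 2 = i / w / 2 ^ l - 1 := by omega
  rw [truncTime, truncTime, div_pow_succ_mul, h3, Nat.sub_mul, one_mul, Nat.mul_sub]

/-- The chain scheme of a binary indexed tree on the multiples of `w`, cut off at level `K`: a time
of level `l < K` is compared to the time `w * 2 ^ l` earlier, and the matrices at times of level `K`
are estimated from scratch. -/
noncomputable def dyadicScheme (m w K : ℕ) (size : Fin (K + 1) → ProbeSize) : ChainScheme m where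
  top := K
  size := size
  level i := ⟨dyadicLevel w K i, Nat.lt_succ_of_le (dyadicLevel_le w K i)⟩
  active := {i | w ∣ i}
  parent j := ⟨j - w * 2 ^ dyadicLevel w K j, (Nat.sub_le _ _).trans_lt j.2⟩
  parent_le _ := Nat.sub_le _ _
  coeff j := if dyadicLevel w K j < K then 1 else 0
  links i := (Finset.range (K + 1)).filter fun l =>
    l = K ∨ truncTime w i l ≠ truncTime w i (l + 1)
  node i l := ⟨truncTime w i l, (truncTime_le w i l).trans_lt i.2⟩
  node_le i l _ := truncTime_le w i l
  node_active _ _ _ := Dvd.intro _ rfl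

namespace dyadicScheme

variable {n m w K : ℕ} {size : Fin (K + 1) → ProbeSize}

theorem card_links_le (i : Fin m) : ((dyadicScheme m w K size).links i).card ≤ K + 1 :=
  (Finset.card_filter_le _ _).trans (Finset.card_range _).le

theorem level_node (hw : 0 < w) {i : Fin m} {l : ℕ} (hl : l ∈ (dyadicScheme m w K size).links i) :
    dyadicLevel w K (truncTime w i l) = l := by
  obtain ⟨h1, h2⟩ := Finset.mem_filter.1 hl
  rcases h2 with rfl | h2
  · exact dyadicLevel_truncTime_top _ _ hw
  · by_cases hK : l < K
    · exact dyadicLevel_truncTime hw hK h2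
    · obtain rfl : l = K := by have := Finset.mem_range.1 h1; omega
      exact dyadicLevel_truncTime_top _ _ hw

theorem increment_node_top (hw : 0 < w) (A : Fin m → Matrix (Fin n) (Fin n) ℝ) (i : Fin m) :
    (dyadicScheme m w K size).increment A ((dyadicScheme m w K size).node i K) =
      A ((dyadicScheme m w K size).node i K) := by
  have h : (dyadicScheme m w K size).coeff ((dyadicScheme m w K size).node i K) = 0 :=
    if_neg (by simp [dyadicScheme, dyadicLevel_truncTime_top K i hw])
  rw [ChainScheme.increment, h, zero_smul, sub_zero]

theorem increment_node_of_lt (hw : 0 < w) (A : Fin m → Matrix (Fin n) (Fin n) ℝ) {i : Fin m} {l : ℕ}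
    (hl : l < K) (h : truncTime w i l ≠ truncTime w i (l + 1)) :
    (dyadicScheme m w K size).increment A ((dyadicScheme m w K size).node i l) =
      A ((dyadicScheme m w K size).node i l) - A ((dyadicScheme m w K size).node i (l + 1)) := by
  have h1 : (dyadicScheme m w K size).coeff ((dyadicScheme m w K size).node i l) = 1 :=
    if_pos (by simpa [dyadicScheme, dyadicLevel_truncTime hw hl h] using hl)
  have h2 : (dyadicScheme m w K size).parent ((dyadicScheme m w K size).node i l) =
      (dyadicScheme m w K size).node i (l + 1) := by
    refine Fin.ext ?_
    simp only [dyadicScheme]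
    rw [dyadicLevel_truncTime hw hl h, truncTime_sub h]
  rw [ChainScheme.increment, h1, h2, one_smul]

/-- The increments along the chain telescope. -/
theorem sum_trace_increment (hw : 0 < w) (A : Fin m → Matrix (Fin n) (Fin n) ℝ) (i : Fin m) :
    ∑ l ∈ (dyadicScheme m w K size).links i,
      ((dyadicScheme m w K size).increment A ((dyadicScheme m w K size).node i l)).trace =
    (A ((dyadicScheme m w K size).node i 0)).trace := by
  set C := dyadicScheme m w K size with hC
  have h1 : ∀ l ∈ Finset.range K, (if l = K ∨ truncTime w i l ≠ truncTime w i (l + 1) then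
      (C.increment A (C.node i l)).trace else 0) =
        (A (C.node i l)).trace - (A (C.node i (l + 1))).trace := by
    intro l hl
    have hl' := Finset.mem_range.1 hl
    by_cases h : truncTime w i l = truncTime w i (l + 1)
    · have h2 : C.node i l = C.node i (l + 1) := Fin.ext h
      rw [if_neg (by simp [h, hl'.ne]), h2, sub_self]
    · rw [if_pos (Or.inr h), hC, increment_node_of_lt hw A hl' h, trace_sub]
  have h3 : C.links i = (Finset.range (K + 1)).filter fun l =>
    l = K ∨ truncTime w i l ≠ truncTime w i (l + 1) := rfl
  rw [h3, Finset.sum_filter, Finset.sum_range_succ, Finset.sum_congr rfl h1,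
    Finset.sum_range_sub', if_pos (Or.inl rfl), hC, increment_node_top hw A i]
  ring

end dyadicScheme

theorem NuclearLE.zero {n : ℕ} : NuclearLE (0 : Matrix (Fin n) (Fin n) ℝ) 0 := by
  intro X _
  simp

theorem NuclearLE.mono {n : ℕ} {D : Matrix (Fin n) (Fin n) ℝ} {s s' : ℝ} (h : NuclearLE D s)
    (hs : s ≤ s') : NuclearLE D s' := fun X hX => (h X hX).trans hs

/-- A stream whose consecutive increments are at most `α` moves by at most `d α` in `d` steps. -/
theorem nuclearLE_sub {n m : ℕ} {A : Fin m → Matrix (Fin n) (Fin n) ℝ} {α : ℝ}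
    (h : ∀ i j : Fin m, (i : ℕ) + 1 = j → NuclearLE (A j - A i) α) (d : ℕ) (i j : Fin m)
    (hij : (i : ℕ) + d = j) : NuclearLE (A j - A i) (d * α) := by
  induction d generalizing j with
  | zero =>
    obtain rfl : i = j := Fin.ext hij
    simpa using NuclearLE.zero
  | succ d ih =>
    have hj := j.2
    have h1 := ih ⟨i + d, by omega⟩ rfl
    have h2 := h ⟨i + d, by omega⟩ j hij
    have h3 := h2.add h1
    rw [sub_add_sub_cancel] at h3
    exact h3.mono (by push_cast; linarith)

theorem card_multiples_le (m q : ℕ) :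
    (((Finset.range m).filter fun j => j ≠ 0 ∧ q ∣ j).card : ℝ) ≤ m / q := by
  have h : ((Finset.range m).filter fun j => j ≠ 0 ∧ q ∣ j) ⊆
      (Finset.Ioc 0 m).filter fun j => q ∣ j := by
    intro j hj
    simp only [Finset.mem_filter, Finset.mem_range, Finset.mem_Ioc] at hj ⊢
    exact ⟨⟨Nat.pos_of_ne_zero hj.2.1, hj.1.le⟩, hj.2.2⟩
  have h2 := Finset.card_le_card h
  rw [Nat.Ioc_filter_dvd_card_eq_div] at h2
  exact (Nat.cast_le.2 h2).trans Nat.cast_div_le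

theorem card_multiples_le_add_one (m q : ℕ) :
    (((Finset.range m).filter fun j => q ∣ j).card : ℝ) ≤ m / q + 1 := by
  have h : ((Finset.range m).filter fun j => q ∣ j) ⊆
      insert 0 ((Finset.range m).filter fun j => j ≠ 0 ∧ q ∣ j) := by
    intro j hj
    simp only [Finset.mem_filter, Finset.mem_insert] at hj ⊢
    tauto
  have h2 := (Finset.card_le_card h).trans (Finset.card_insert_le _ _)
  have h3 := card_multiples_le m q
  have h4 : (((Finset.range m).filter fun j => q ∣ j).card : ℝ) ≤
      ((Finset.range m).filter fun j => j ≠ 0 ∧ q ∣ j).card + 1 := by exact_mod_cast h2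
  linarith

/-- The times of level `l < K` are nonzero multiples of `w * 2 ^ l`, and those of level `K` are
multiples of `w * 2 ^ K`. -/
theorem totalQueries_dyadicScheme_le {m w K : ℕ} [NeZero m] (size : Fin (K + 1) → ProbeSize)
    (N : ℕ → ℝ) (hN : ∀ l, ((size l).numQueries : ℝ) ≤ N l) (n : ℕ) :
    (((dyadicScheme m w K size).toOnline n).totalQueries : ℝ) ≤
      ∑ l ∈ Finset.range K, m / (w * 2 ^ l) * (2 * N l) + (m / (w * 2 ^ K) + 1) * (2 * N K) := by
  classical
  have hN0 : ∀ l < K + 1, 0 ≤ N l := fun l hl => (Nat.cast_nonneg _).trans (hN ⟨l, hl⟩)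
  have h0 : (((dyadicScheme m w K size).toOnline n).totalQueries : ℝ) ≤
      ∑ j ∈ Finset.range m, if w ∣ j then 2 * N (dyadicLevel w K j) else 0 := by
    refine (Nat.cast_le.2 (ChainScheme.totalQueries_toOnline_le _ n)).trans ?_
    push_cast
    refine Finset.sum_le_sum fun j _ => ?_
    by_cases hj : w ∣ j
    · rw [if_pos hj, if_pos (by exact hj)]
      have := hN ⟨dyadicLevel w K j, Nat.lt_succ_of_le (dyadicLevel_le w K j)⟩
      exact mul_le_mul_of_nonneg_left this zero_le_two
    · rw [if_neg hj, if_neg (by exact hj)]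
  have h1 : ∀ j ∈ Finset.range m, (if w ∣ j then 2 * N (dyadicLevel w K j) else 0) ≤
      ∑ l ∈ Finset.range K, (if j ≠ 0 ∧ w * 2 ^ l ∣ j then 2 * N l else 0) +
        if w * 2 ^ K ∣ j then 2 * N K else 0 := by
    intro j _
    have hs : ∀ l ∈ Finset.range K, 0 ≤ (if j ≠ 0 ∧ w * 2 ^ l ∣ j then 2 * N l else 0) := by
      intro l hl
      have := hN0 l ((Finset.mem_range.1 hl).trans (Nat.lt_succ_self K))
      split_ifs <;> linarith
    have hK := hN0 K (Nat.lt_succ_self K)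
    have hlast : 0 ≤ if w * 2 ^ K ∣ j then 2 * N K else 0 := by split_ifs <;> linarith
    by_cases hj : w ∣ j
    · rw [if_pos hj]
      have hd := dvd_of_dyadicLevel K hj
      rcases (dyadicLevel_le w K j).eq_or_lt with hl | hl
      · rw [hl] at hd ⊢
        rw [if_pos hd]
        linarith [Finset.sum_nonneg hs]
      · have hj0 : j ≠ 0 := by
          rintro rfl
          rw [dyadicLevel_zero] at hl
          exact lt_irrefl _ hl
        have h2 := Finset.single_le_sum hs (Finset.mem_range.2 hl)
        rw [if_pos ⟨hj0, hd⟩] at h2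
        linarith
    · rw [if_neg hj]
      linarith [Finset.sum_nonneg hs]
  refine h0.trans ((Finset.sum_le_sum h1).trans ?_)
  rw [Finset.sum_add_distrib, Finset.sum_comm]
  refine add_le_add (Finset.sum_le_sum fun l hl => ?_) ?_
  · rw [← Finset.sum_filter, Finset.sum_const, nsmul_eq_mul]
    have h2 := card_multiples_le m (w * 2 ^ l)
    push_cast at h2
    have := hN0 l ((Finset.mem_range.1 hl).trans (Nat.lt_succ_self K))
    exact mul_le_mul_of_nonneg_right h2 (by linarith)
  · rw [← Finset.sum_filter, Finset.sum_const, nsmul_eq_mul]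
    have h2 := card_multiples_le_add_one m (w * 2 ^ K)
    push_cast at h2
    have := hN0 K (Nat.lt_succ_self K)
    exact mul_le_mul_of_nonneg_right h2 (by linarith)

/-! ### Scales and costs of the dyadic scheme -/

/-- The scale parameters of the dyadic scheme: `w` is the number of steps in which the trace cannot
move by more than `ε / 2`, and `K` the level at which increments are as large as the matrices. -/
theorem exists_scales {α ε : ℝ} (hα : 0 < α) (hα1 : α < 1) (hε : 0 < ε) :
    ∃ w K : ℕ, 0 < w ∧ ((w : ℝ) - 1) * α ≤ ε / 2 ∧ (1 : ℝ) / w ≤ 4 * min 1 (α / ε) ∧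
      1 ≤ w * 2 ^ K * α ∧ (2 : ℝ) ^ K ≤ 2 / α := by
  set z := ε / (2 * α) with hz
  have hz0 : 0 < z := by positivity
  have hzα : z * α = ε / 2 := by rw [hz]; field_simp
  set w := max 1 ⌊z⌋₊ with hw
  have hw0 : 0 < w := lt_max_of_lt_left one_pos
  have hw1 : (1 : ℝ) ≤ w := by exact_mod_cast hw0
  have hwz : (w : ℝ) - 1 ≤ z := by
    rcases le_total 1 ⌊z⌋₊ with h | h
    · rw [hw, max_eq_right h]
      linarith [Nat.floor_le hz0.le]
    · rw [hw, max_eq_left h]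
      push_cast
      linarith
  have hzw : z ≤ 2 * w := by
    have h1 : (⌊z⌋₊ : ℝ) ≤ w := by exact_mod_cast le_max_right 1 ⌊z⌋₊
    linarith [Nat.lt_floor_add_one z]
  have hex : ∃ K : ℕ, 1 ≤ w * 2 ^ K * α := by
    obtain ⟨K, hK⟩ := pow_unbounded_of_one_lt (1 / α) (one_lt_two (α := ℝ))
    refine ⟨K, ?_⟩
    rw [div_lt_iff₀ hα] at hK
    have : (2 : ℝ) ^ K * α ≤ w * (2 ^ K * α) := le_mul_of_one_le_left (by positivity) hw1
    linarith
  classical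
  refine ⟨w, Nat.find hex, hw0, ?_, ?_, Nat.find_spec hex, ?_⟩
  · rw [← hzα]
    gcongr
  · rw [← div_le_iff₀' (by norm_num), le_min_iff]
    constructor
    · rw [div_div, div_le_one (by positivity)]
      linarith
    · rw [div_div, div_le_div_iff₀ (by positivity) hε]
      nlinarith
  · rcases Nat.eq_zero_or_pos (Nat.find hex) with h | h
    · rw [h, pow_zero, le_div_iff₀ hα]
      linarith
    · have h1 := Nat.find_min hex (Nat.sub_lt h one_pos)
      rw [not_le] at h1
      obtain ⟨k, hk⟩ := Nat.exists_eq_succ_of_ne_zero h.ne'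
      rw [hk] at h1 ⊢
      simp only [Nat.succ_eq_add_one, Nat.add_sub_cancel] at h1 ⊢
      rw [le_div_iff₀ hα, pow_succ]
      have : (2 : ℝ) ^ k * α ≤ w * (2 ^ k * α) := le_mul_of_one_le_left (by positivity) hw1
      linarith

theorem add_one_le_of_two_pow_le {α : ℝ} {K : ℕ} (hα : 0 < α) (hα1 : α < 1)
    (h : (2 : ℝ) ^ K ≤ 2 / α) : (K : ℝ) + 1 ≤ 3 * Real.log (2 / α) := by
  have h1 : K * Real.log 2 ≤ Real.log (2 / α) := by
    rw [← Real.log_pow]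
    exact Real.log_le_log (by positivity) h
  have h2 : Real.log 2 ≤ Real.log (2 / α) := by
    refine Real.log_le_log two_pos ?_
    rw [le_div_iff₀ hα]
    linarith
  have h3 := Real.log_two_gt_d9
  nlinarith

theorem log_two_le {α δ : ℝ} (hα : 0 < α) (hα1 : α < 1) (hδ : 0 < δ) (hδ2 : δ ≤ 1 / 2) :
    Real.log 2 ≤ Real.log (1 / (α * δ)) := by
  refine Real.log_le_log two_pos ?_
  rw [le_div_iff₀ (by positivity)]
  nlinarith

/-- The failure probability per link which makes the union bound over the chain work. -/
theorem half_pow_ceil_le {α δ : ℝ} (hα : 0 < α) (hα1 : α < 1) (hδ : 0 < δ) (hδ2 : δ ≤ 1 / 2) :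
    ((1 : ℝ) / 2) ^ ⌈5 * Real.log (1 / (α * δ))⌉₊ ≤ α * δ / 4 := by
  have h2 := log_two_le hα hα1 hδ hδ2
  set L := Real.log (1 / (α * δ)) with hL
  have h3 := Real.log_two_gt_d9
  have hαδ : α * δ = Real.exp (-L) := by
    rw [hL, one_div, Real.log_inv, neg_neg, Real.exp_log (by positivity)]
  have h4 : (4 : ℝ) = Real.exp (2 * Real.log 2) := by
    rw [two_mul, Real.exp_add, Real.exp_log two_pos]
    norm_num
  have h5 : (1 : ℝ) / 2 = Real.exp (-Real.log 2) := by
    rw [Real.exp_neg, Real.exp_log two_pos, one_div]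
  rw [hαδ, h4, h5, ← Real.exp_nat_mul, ← Real.exp_sub]
  refine Real.exp_le_exp.2 ?_
  have h6 := Nat.le_ceil (5 * L)
  nlinarith

theorem sum_inv_two_pow_le (K : ℕ) : ∑ l ∈ Finset.range K, (1 : ℝ) / 2 ^ l ≤ 2 := by
  have := sum_geometric_two_le K
  simpa [_root_.one_div_pow] using this

/-- The total cost of the dyadic scheme: every level contributes `O(m α √l / η)` to the first part
of the bound, and the second part is a geometric series over the levels. -/
theorem dyadic_cost_le {m w K : ℕ} {α ε l M : ℝ} (hα : 0 < α) (hε : 0 < ε) (hl : 0 ≤ l)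
    (hw : 0 < w) (hK : 1 ≤ w * 2 ^ K * α) (hwM : (1 : ℝ) / w ≤ 4 * M) (hαM : α ≤ M) :
    ∑ j ∈ Finset.range K, (m : ℝ) / (w * 2 ^ j) *
        (2 * (140 * (w * 2 ^ j * α * √l / (ε / (2 * (K + 1)))) + 25 * l)) +
      (m / (w * 2 ^ K) + 1) * (2 * (140 * (1 * √l / (ε / (2 * (K + 1)))) + 25 * l)) ≤
    560 * ((K + 1) ^ 2 * (m * α + 1) * √l / ε) + 450 * (l * (m * M + 1)) := by
  have hw' : (0 : ℝ) < w := by exact_mod_cast hw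
  have hm : (0 : ℝ) ≤ m := Nat.cast_nonneg m
  set B := √l / (ε / (2 * (K + 1))) with hB
  have hB0 : 0 ≤ B := by positivity
  have h1 : ∀ j ∈ Finset.range K, (m : ℝ) / (w * 2 ^ j) *
        (2 * (140 * (w * 2 ^ j * α * √l / (ε / (2 * (K + 1)))) + 25 * l)) =
      280 * (m * α * B) + 50 * l * m * (1 / w) * (1 / 2 ^ j) := by
    intro j _
    rw [mul_div_assoc, ← hB]
    field_simp
    ring
  rw [Finset.sum_congr rfl h1, Finset.sum_add_distrib, Finset.sum_const,
    Finset.card_range, nsmul_eq_mul, ← Finset.mul_sum, mul_div_assoc, ← hB, one_mul]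
  have h2 : 50 * l * m * (1 / w) * ∑ j ∈ Finset.range K, (1 : ℝ) / 2 ^ j ≤
      50 * l * m * (4 * M) * 2 := by
    have := sum_inv_two_pow_le K
    have hM : 0 ≤ M := hα.le.trans hαM
    gcongr
  have h3 : (m : ℝ) / (w * 2 ^ K) ≤ m * α := by
    rw [div_le_iff₀ (by positivity)]
    nlinarith
  have h4 : ((m : ℝ) / (w * 2 ^ K) + 1) * (2 * (140 * B + 25 * l)) ≤
      (m * α + 1) * (2 * (140 * B + 25 * l)) := by gcongr
  have h5 : l * (m * α) ≤ l * (m * M) := by gcongr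
  have h6 : 560 * ((K + 1) ^ 2 * (m * α + 1) * √l / ε) = 280 * ((K + 1) * (m * α + 1) * B) := by
    rw [hB]
    field_simp
    ring
  rw [h6]
  have h7 : 0 ≤ K * B := by positivity
  nlinarith

/-- The dyadic scheme proves the theorem for `δ ≤ 1 / 2` and `ε < 1`. -/
theorem exists_dyadic_algorithm {n m : ℕ} {α δ ε : ℝ} (hm : 1 ≤ m) (hα : 0 < α) (hα1 : α < 1)
    (hδ : 0 < δ) (hδ2 : δ ≤ 1 / 2) (hε : 0 < ε) (hε1 : ε < 1) :
    ∃ alg : OnlineMatVecAlgorithm n m,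
      (alg.totalQueries : ℝ) ≤
          20000 * ((m * α + 1) * Real.log (2 / α) ^ 2 * √(Real.log (1 / (α * δ))) / ε
            + (m * min 1 (α / ε) + 1) * Real.log (1 / (α * δ))) ∧
        ∀ A : Fin m → Matrix (Fin n) (Fin n) ℝ,
          (∀ i : Fin m, nuclearNorm (A i) ≤ 1) →
          (∀ i j : Fin m, (i : ℕ) + 1 = (j : ℕ) → nuclearNorm (A j - A i) ≤ α) →
          ∀ i : Fin m,
            1 - δ ≤ alg.P.real {ω | |alg.output A i ω - (A i).trace| ≤ ε} := by
  classical
  have : NeZero m := ⟨by omega⟩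
  obtain ⟨w, K, hw, hwα, hwM, hK, hK2⟩ := exists_scales hα hα1 hε
  have hw' : (0 : ℝ) < w := by exact_mod_cast hw
  have hLlog := log_two_le hα hα1 hδ hδ2
  have hhalf := half_pow_ceil_le hα hα1 hδ hδ2
  have hlog2 := Real.log_two_gt_d9
  set L := Real.log (1 / (α * δ)) with hL
  have hL0 : 0 < L := by linarith
  set l := ⌈5 * L⌉₊ with hl
  have hl0 : 0 < l := Nat.ceil_pos.2 (by positivity)
  have hl7 : (l : ℝ) ≤ 7 * L := by
    have := Nat.ceil_lt_add_one (show 0 ≤ 5 * L by positivity)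
    linarith
  set η := ε / (2 * ((K : ℝ) + 1)) with hη
  have hη0 : 0 < η := by positivity
  set s : ℕ → ℝ := fun j => if j < K then w * 2 ^ j * α else 1 with hs
  have hs0 : ∀ j, 0 < s j := fun j => by
    simp only [hs]; split_ifs <;> positivity
  choose size hsize hacc using fun x : Fin (K + 1) => exists_probeSize (hs0 x) hη0 hl0
  refine ⟨(dyadicScheme m w K size).toOnline n, ?_, fun A hA hA' i => ?_⟩
  · refine (totalQueries_dyadicScheme_le size
      (fun j => 140 * (s j * √l / η) + 25 * l) hsize n).trans ?_
    have hsum : ∀ j ∈ Finset.range K, (m : ℝ) / (w * 2 ^ j) *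
        (2 * (140 * (s j * √l / η) + 25 * l)) = (m : ℝ) / (w * 2 ^ j) *
        (2 * (140 * (w * 2 ^ j * α * √l / (ε / (2 * (K + 1)))) + 25 * l)) := by
      intro j hj
      simp only [hs, if_pos (Finset.mem_range.1 hj), hη]
    have hsK : s K = 1 := if_neg (lt_irrefl K)
    have hαM : α ≤ min 1 (α / ε) := by
      refine le_min hα1.le ?_
      rw [le_div_iff₀ hε]
      nlinarith
    rw [Finset.sum_congr rfl hsum, hsK]
    refine (dyadic_cost_le hα hε (Nat.cast_nonneg l) hw hK hwM hαM).trans ?_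
    have hK3 := add_one_le_of_two_pow_le hα hα1 hK2
    have hsqrt : √(l : ℝ) ≤ 3 * √L := by
      rw [show (3 : ℝ) = √9 by rw [show (9 : ℝ) = 3 ^ 2 by norm_num]; simp,
        ← Real.sqrt_mul (by norm_num)]
      exact Real.sqrt_le_sqrt (by linarith)
    have h1 : ((K : ℝ) + 1) ^ 2 * (m * α + 1) * √(l : ℝ) / ε ≤
        (3 * Real.log (2 / α)) ^ 2 * (m * α + 1) * (3 * √L) / ε := by gcongr
    have h2 : (l : ℝ) * (m * min 1 (α / ε) + 1) ≤ 7 * L * (m * min 1 (α / ε) + 1) := by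
      have : 0 ≤ min 1 (α / ε) := hα.le.trans hαM
      gcongr
    have h3 : (3 * Real.log (2 / α)) ^ 2 * (m * α + 1) * (3 * √L) / ε =
        27 * ((m * α + 1) * Real.log (2 / α) ^ 2 * √L / ε) := by ring
    rw [h3] at h1
    have h4 : 0 ≤ (m * α + 1) * Real.log (2 / α) ^ 2 * √L / ε := by positivity
    have h5 : 0 ≤ (m * min 1 (α / ε) + 1) * L := by
      have : 0 ≤ min 1 (α / ε) := hα.le.trans hαM
      positivity
    linarith
  · have hN := fun i => NuclearLE.of_nuclearNorm_le (hA i)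
    have hN' := fun i j hij => NuclearLE.of_nuclearNorm_le (hA' i j hij)
    set C := dyadicScheme m w K size with hC
    have hq : ∀ j ∈ C.links i, 𝔼 ω : (C.size (C.level (C.node i j))).Seed n,
        (if ∃ d, (C.size (C.level (C.node i j))).IsAnswer (C.increment A (C.node i j)) ω d ∧
          η < |(C.size (C.level (C.node i j))).estimate ω d - (C.increment A (C.node i j)).trace|
        then (1 : ℝ) else 0) ≤ 2 * (1 / 2) ^ l := by
      intro j hj
      refine hacc (C.level (C.node i j)) n _ ?_
      have hlev : ((C.level (C.node i j) : Fin (K + 1)) : ℕ) = j := dyadicScheme.level_node hw hj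
      obtain ⟨hj1, hj2⟩ := Finset.mem_filter.1 hj
      change NuclearLE _ (s ((C.level (C.node i j) : Fin (K + 1)) : ℕ))
      rw [hlev]
      by_cases hjK : j < K
      · have hne : truncTime w i j ≠ truncTime w i (j + 1) := hj2.resolve_left hjK.ne
        rw [hC, dyadicScheme.increment_node_of_lt hw A hjK hne]
        have hsub := truncTime_sub hne
        refine (nuclearLE_sub hN' (truncTime w i j - truncTime w i (j + 1)) _ _ ?_).mono ?_
        · change truncTime w i (j + 1) + _ = truncTime w i j
          omega
        · have h1 : truncTime w i j - truncTime w i (j + 1) ≤ w * 2 ^ j := by omega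
          simp only [hs, if_pos hjK]
          have h2 : ((truncTime w i j - truncTime w i (j + 1) : ℕ) : ℝ) ≤ w * 2 ^ j := by
            exact_mod_cast h1
          gcongr
      · obtain rfl : j = K := by have := Finset.mem_range.1 hj1; omega
        rw [hC, dyadicScheme.increment_node_top hw A i]
        simp only [hs, lt_irrefl, if_false]
        exact hN _
    have hmain := C.prob_toOnline_ge A i hq
    rw [hC, dyadicScheme.sum_trace_increment hw A i, ← hC] at hmain
    have hcard : ((C.links i).card : ℝ) ≤ K + 1 := by
      exact_mod_cast dyadicScheme.card_links_le i
    have hδ' : ((C.links i).card : ℝ) * (2 * (1 / 2) ^ l) ≤ δ := by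
      have h1 : ((K : ℝ) + 1) ≤ 2 ^ K := by exact_mod_cast Nat.lt_two_pow_self
      calc ((C.links i).card : ℝ) * (2 * (1 / 2) ^ l) ≤ 2 / α * (2 * (α * δ / 4)) := by
            gcongr
            linarith
        _ = δ := by field_simp; norm_num
    refine le_trans (by linarith) (hmain.trans (measureReal_mono fun ω hω => ?_))
    -- rounding `i` down to a multiple of `w` moves the trace by at most `ε / 2`
    have hround : |(A (C.node i 0)).trace - (A i).trace| ≤ ε / 2 := by
      have hval : ((C.node i 0 : Fin m) : ℕ) = w * (i / w) := by
        simp [hC, dyadicScheme, truncTime]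
      have hmod := Nat.div_add_mod (i : ℕ) w
      have hlt := Nat.mod_lt (i : ℕ) hw
      have h1 := (nuclearLE_sub hN' (i % w) (C.node i 0) i (by rw [hval]; exact hmod)).abs_trace_le
      rw [trace_sub, abs_sub_comm] at h1
      refine h1.trans (le_trans ?_ hwα)
      have h2 : ((i % w : ℕ) : ℝ) ≤ (w : ℝ) - 1 := by
        have : ((i % w : ℕ) : ℝ) + 1 ≤ w := by exact_mod_cast hlt
        linarith
      gcongr
    have herr : ((C.links i).card : ℝ) * η ≤ ε / 2 := by
      calc ((C.links i).card : ℝ) * η ≤ (K + 1) * η := by gcongr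
        _ = ε / 2 := by rw [hη]; field_simp
    have hω' : |(C.toOnline n).output A i ω - (A (C.node i 0)).trace| ≤ _ := hω
    have h3 := abs_sub_le ((C.toOnline n).output A i ω) (A (C.node i 0)).trace (A i).trace
    exact (h3.trans (add_le_add (hω'.trans herr) hround)).trans (by linarith)

/-! ### Random noise and the remaining parameter ranges -/

namespace OnlineMatVecAlgorithm

variable {n m : ℕ} (alg : OnlineMatVecAlgorithm n m)

/-- The law of a seed of `alg` together with an independent uniform element of `Fin M`. -/
noncomputable def noiseLaw (M : ℕ) : Measure (alg.Ω × Fin M) :=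
  (M : ENNReal)⁻¹ • ∑ j : Fin M, alg.P.map fun ω => (ω, j)

theorem isProbabilityMeasure_noiseLaw {M : ℕ} (hM : 0 < M) :
    IsProbabilityMeasure (alg.noiseLaw M) := by
  have h : ∀ j : Fin M, (alg.P.map fun ω => (ω, j)) Set.univ = 1 := fun j => by
    rw [Measure.map_apply (by fun_prop) .univ, Set.preimage_univ, measure_univ]
  constructor
  rw [noiseLaw, Measure.smul_apply, Measure.finsetSum_apply]
  simp only [h]
  simp [ENNReal.inv_mul_cancel (Nat.cast_ne_zero.2 hM.ne') (ENNReal.natCast_ne_top M)]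

/-- The algorithm `alg` with its outputs shifted by a random element of a grid of `M` points of
mesh `2 * ε`, centred at `0`. -/
noncomputable def addNoise {M : ℕ} (hM : 0 < M) (ε : ℝ) : OnlineMatVecAlgorithm n m where
  Ω := alg.Ω × Fin M
  P := alg.noiseLaw M
  isProbabilityMeasure := alg.isProbabilityMeasure_noiseLaw hM
  target k ω h := alg.target k ω.1 h
  vector k ω h := alg.vector k ω.1 h
  queriesBefore := alg.queriesBefore
  estimate i ω h := alg.estimate i ω.1 h + (2 * (ω.2 : ℕ) + 1 - M) * ε
  measurable_target k := (alg.measurable_target k).comp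
    (f := fun p : (alg.Ω × Fin M) × (Fin k → Fin n → ℝ) => (p.1.1, p.2)) (by fun_prop)
  measurable_vector k := (alg.measurable_vector k).comp
    (f := fun p : (alg.Ω × Fin M) × (Fin k → Fin n → ℝ) => (p.1.1, p.2)) (by fun_prop)
  measurable_estimate i := by
    refine ((alg.measurable_estimate i).comp (f := fun p : (alg.Ω × Fin M) ×
      (Fin (alg.queriesBefore i) → Fin n → ℝ) => (p.1.1, p.2)) (by fun_prop)).add ?_
    exact (measurable_of_countable fun j : Fin M => (2 * ((j : ℕ) : ℝ) + 1 - M) * ε).comp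
      (measurable_snd.comp measurable_fst)
  monotone_queriesBefore := alg.monotone_queriesBefore
  online i k hk ω h := alg.online i k hk ω.1 h

theorem answers_addNoise {M : ℕ} (hM : 0 < M) (ε : ℝ) (A : Fin m → Matrix (Fin n) (Fin n) ℝ)
    (ω : alg.Ω × Fin M) (k : ℕ) :
    (alg.addNoise hM ε).answers A ω k = alg.answers A ω.1 k := by
  induction k with
  | zero => rfl
  | succ k ih =>
    change Fin.snoc (α := fun _ => Fin n → ℝ) ((alg.addNoise hM ε).answers A ω k)
      (A (alg.target k ω.1 ((alg.addNoise hM ε).answers A ω k)) *ᵥ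
        alg.vector k ω.1 ((alg.addNoise hM ε).answers A ω k)) = _
    rw [ih]
    rfl

theorem output_addNoise {M : ℕ} (hM : 0 < M) (ε : ℝ) (A : Fin m → Matrix (Fin n) (Fin n) ℝ)
    (i : Fin m) (ω : alg.Ω × Fin M) : (alg.addNoise hM ε).output A i ω =
      alg.output A i ω.1 + (2 * (ω.2 : ℕ) + 1 - M) * ε := by
  change alg.estimate i ω.1 ((alg.addNoise hM ε).answers A ω (alg.queriesBefore i)) + _ = _
  rw [answers_addNoise]
  rfl

/-- The grid used by `addNoise` has mesh `2 ε` and covers `[-M ε, M ε]` up to `ε`. -/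
theorem exists_grid_near {M : ℕ} (hM : 0 < M) {ε x : ℝ} (hε : 0 < ε) (hx : |x| ≤ M * ε) :
    ∃ j : Fin M, |x + (2 * (j : ℕ) + 1 - M) * ε| ≤ ε := by
  have hM' : (0 : ℝ) < M := by exact_mod_cast hM
  obtain ⟨hx1, hx2⟩ := abs_le.1 hx
  -- `j` is the index of the cell of length `2 ε` containing `- x`
  set y := (M * ε - x) / (2 * ε) with hy
  have hyx : y * (2 * ε) = M * ε - x := by rw [hy]; field_simp
  have hy0 : 0 ≤ y := div_nonneg (by linarith) (by positivity)
  have hyM : y ≤ M := by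
    rw [hy, div_le_iff₀ (by positivity)]
    linarith
  have hf1 := Nat.floor_le hy0
  have hf2 := Nat.lt_floor_add_one y
  rcases lt_or_ge ⌊y⌋₊ M with h | h
  · refine ⟨⟨⌊y⌋₊, h⟩, abs_le.2 ⟨?_, ?_⟩⟩ <;> simp only <;> nlinarith
  · have hMy : y = M := le_antisymm hyM ((Nat.cast_le.2 h).trans hf1)
    refine ⟨⟨M - 1, by omega⟩, ?_⟩
    have h1 : ((M - 1 : ℕ) : ℝ) = M - 1 := by rw [Nat.cast_sub hM]; simp
    rw [hMy] at hyx
    simp only [h1]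
    rw [abs_le]
    constructor <;> nlinarith

/-- Random noise turns a coarse estimate into a fine one, at the price of a small success
probability. -/
theorem prob_addNoise_ge {M : ℕ} (hM : 0 < M) {ε : ℝ} (hε : 0 < ε)
    (A : Fin m → Matrix (Fin n) (Fin n) ℝ) (i : Fin m) (t : ℝ) :
    alg.P.real {ω | |alg.output A i ω - t| ≤ M * ε} / M ≤
      (alg.addNoise hM ε).P.real {ω | |(alg.addNoise hM ε).output A i ω - t| ≤ ε} := by
  set S : Set (alg.Ω × Fin M) := {ω | |(alg.addNoise hM ε).output A i ω - t| ≤ ε} with hS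
  have hcover : {ω | |alg.output A i ω - t| ≤ M * ε} ⊆ ⋃ j : Fin M, (fun ω => (ω, j)) ⁻¹' S := by
    intro ω hω
    obtain ⟨j, hj⟩ := exists_grid_near hM hε hω
    refine Set.mem_iUnion.2 ⟨j, ?_⟩
    change |(alg.addNoise hM ε).output A i (ω, j) - t| ≤ ε
    rw [output_addNoise]
    convert hj using 2
    ring
  have h1 : alg.P {ω | |alg.output A i ω - t| ≤ M * ε} ≤
      ∑ j : Fin M, (alg.P.map fun ω => (ω, j)) S := by
    refine (measure_mono hcover).trans ((measure_iUnion_fintype_le _ _).trans ?_)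
    exact Finset.sum_le_sum fun j _ => Measure.le_map_apply (by fun_prop) S
  have h2 : (M : ENNReal)⁻¹ * alg.P {ω | |alg.output A i ω - t| ≤ M * ε} ≤ alg.noiseLaw M S := by
    rw [noiseLaw, Measure.smul_apply, Measure.finsetSum_apply, smul_eq_mul]
    gcongr
  have : IsProbabilityMeasure (alg.noiseLaw M) := alg.isProbabilityMeasure_noiseLaw hM
  have h3 := ENNReal.toReal_mono (measure_ne_top (alg.noiseLaw M) S) h2
  rw [ENNReal.toReal_mul, ENNReal.toReal_inv, ENNReal.toReal_natCast, ← div_eq_inv_mul] at h3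
  exact h3

/-- The algorithm that outputs `0` without making any query. -/
noncomputable def trivial (n m : ℕ) [NeZero m] : OnlineMatVecAlgorithm n m where
  Ω := Unit
  P := Measure.dirac ()
  target _ _ _ := 0
  vector _ _ _ := 0
  queriesBefore _ := 0
  estimate _ _ _ := 0
  measurable_target _ := measurable_const
  measurable_vector _ := measurable_const
  measurable_estimate _ := measurable_const
  monotone_queriesBefore := monotone_const
  online _ _ hk _ _ := absurd hk (Nat.not_lt_zero _)

theorem totalQueries_trivial (n m : ℕ) [NeZero m] : (trivial n m).totalQueries = 0 :=
  Nat.le_zero.1 (Finset.sup_le fun _ _ => le_rfl)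

theorem prob_trivial [NeZero m] {A : Fin m → Matrix (Fin n) (Fin n) ℝ} {i : Fin m} {ε : ℝ}
    (hA : nuclearNorm (A i) ≤ 1) (hε : 1 ≤ ε) :
    (trivial n m).P.real {ω | |(trivial n m).output A i ω - (A i).trace| ≤ ε} = 1 := by
  have h : {ω | |(trivial n m).output A i ω - (A i).trace| ≤ ε} = Set.univ := by
    refine Set.eq_univ_of_forall fun ω => ?_
    change |0 - (A i).trace| ≤ ε
    rw [zero_sub, abs_neg]
    exact (NuclearLE.of_nuclearNorm_le hA).abs_trace_le.trans hε
  rw [h]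
  exact probReal_univ

end OnlineMatVecAlgorithm

/-- If both `α` and `δ` are close to `1`, estimates of accuracy `ε / √L` with
`L = log (1 / (α δ))` suffice: after random noise they are within `ε` with probability of order
`√L`, which exceeds `1 - δ ≤ L`. -/
theorem exists_noisy_algorithm {n m : ℕ} {α δ ε : ℝ} (hm : 1 ≤ m) (hα : 0 < α) (hα1 : α < 1)
    (hδ : 0 < δ) (hδ1 : δ < 1) (hε : 0 < ε) (hL : Real.log (1 / (α * δ)) < 1 / 16) :
    ∃ alg : OnlineMatVecAlgorithm n m,
      (alg.totalQueries : ℝ) ≤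
          1000000 * ((m * α + 1) * Real.log (2 / α) ^ 2 * √(Real.log (1 / (α * δ))) / ε
            + (m * min 1 (α / ε) + 1) * Real.log (1 / (α * δ))) ∧
        ∀ A : Fin m → Matrix (Fin n) (Fin n) ℝ,
          (∀ i : Fin m, nuclearNorm (A i) ≤ 1) →
          (∀ i j : Fin m, (i : ℕ) + 1 = (j : ℕ) → nuclearNorm (A j - A i) ≤ α) →
          ∀ i : Fin m,
            1 - δ ≤ alg.P.real {ω | |alg.output A i ω - (A i).trace| ≤ ε} := by
  have : NeZero m := ⟨by omega⟩
  have hlog2 := Real.log_two_gt_d9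
  have hlog2' := Real.log_two_lt_d9
  have hαδ : α * δ < 1 := by nlinarith
  have hLδ : 1 - δ ≤ Real.log (1 / (α * δ)) := by
    have h1 : Real.log (1 / (α * δ)) = -Real.log (α * δ) := by rw [one_div, Real.log_inv]
    have h2 := Real.log_le_sub_one_of_pos (mul_pos hα hδ)
    nlinarith
  have hlogα : Real.log (1 / α) < 1 / 16 := by
    refine lt_of_le_of_lt (Real.log_le_log (by positivity) ?_) hL
    gcongr
    nlinarith
  set L := Real.log (1 / (α * δ)) with hLdef
  have hL0 : 0 < L := Real.log_pos ((one_lt_div (by positivity)).2 hαδ)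
  set r := √L with hr
  have hr0 : 0 < r := Real.sqrt_pos.2 hL0
  have hrr : r * r = L := Real.mul_self_sqrt hL0.le
  have hr4 : r < 1 / 4 := by nlinarith
  set ε' := ε / r with hε'
  have hε'0 : 0 < ε' := by positivity
  set M := ⌈1 / r⌉₊ with hM
  have hM0 : 0 < M := Nat.ceil_pos.2 (by positivity)
  have hM0' : (0 : ℝ) < M := by exact_mod_cast hM0
  have hMr : 1 / r ≤ M := Nat.le_ceil _
  have hMr' : (M : ℝ) < 1 / r + 1 := Nat.ceil_lt_add_one (by positivity)
  have hMε : ε' ≤ M * ε := by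
    rw [hε', div_eq_mul_one_div, mul_comm]
    gcongr
  have hLM : 1 - δ ≤ 1 / 2 / M := by
    rw [le_div_iff₀ hM0']
    have h1 : (1 - δ) * M ≤ L * (1 / r + 1) := by gcongr
    have h2 : L * (1 / r + 1) = r + L := by
      rw [← hrr]
      field_simp
    linarith
  suffices h : ∃ alg : OnlineMatVecAlgorithm n m,
      (alg.totalQueries : ℝ) ≤
          1000000 * ((m * α + 1) * Real.log (2 / α) ^ 2 * r / ε + (m * min 1 (α / ε) + 1) * L) ∧
        ∀ A : Fin m → Matrix (Fin n) (Fin n) ℝ,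
          (∀ i : Fin m, nuclearNorm (A i) ≤ 1) →
          (∀ i j : Fin m, (i : ℕ) + 1 = (j : ℕ) → nuclearNorm (A j - A i) ≤ α) →
          ∀ i : Fin m, 1 / 2 ≤ alg.P.real {ω | |alg.output A i ω - (A i).trace| ≤ ε'} by
    obtain ⟨alg, hcost, halg⟩ := h
    refine ⟨alg.addNoise hM0 ε, hcost, fun A hA hA' i => ?_⟩
    refine hLM.trans (le_trans ?_ (alg.prob_addNoise_ge hM0 hε A i (A i).trace))
    gcongr
    exact (halg A hA hA' i).trans (measureReal_mono fun ω hω => le_trans hω hMε)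
  have hnonneg : 0 ≤ (m * min 1 (α / ε) + 1) * L := by
    have : 0 ≤ min 1 (α / ε) := by positivity
    positivity
  rcases le_or_gt 1 ε' with h1 | h1
  · refine ⟨.trivial n m, ?_, fun A hA hA' i => ?_⟩
    · rw [OnlineMatVecAlgorithm.totalQueries_trivial, Nat.cast_zero]
      positivity
    · rw [OnlineMatVecAlgorithm.prob_trivial (hA i) h1]
      norm_num
  · obtain ⟨alg, hcost, halg⟩ := exists_dyadic_algorithm (n := n) hm hα hα1
      (one_half_pos : (0 : ℝ) < 1 / 2) le_rfl hε'0 h1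
    refine ⟨alg, hcost.trans ?_, fun A hA hA' i => ?_⟩
    · have hL1 : Real.log (1 / (α * (1 / 2))) ≤ 1 := by
        have h2 : 1 / (α * (1 / 2)) = 1 / α * 2 := by field_simp
        rw [h2, Real.log_mul (by positivity) two_ne_zero]
        linarith
      have hL1' : √(Real.log (1 / (α * (1 / 2)))) ≤ 1 := Real.sqrt_le_one.2 hL1
      have hlog : 1 / 4 ≤ Real.log (2 / α) ^ 2 := by
        have h2 : Real.log 2 ≤ Real.log (2 / α) := by
          refine Real.log_le_log two_pos ?_
          rw [le_div_iff₀ hα]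
          linarith
        nlinarith
      have hα2 : 1 / 2 ≤ α := by
        have h2 := Real.one_sub_inv_le_log_of_pos (show 0 < 1 / α by positivity)
        rw [one_div, inv_inv] at h2
        rw [one_div] at hlogα
        linarith
      set G := Real.log (2 / α) ^ 2 with hG
      have hmin : min 1 (α / ε') ≤ 1 := min_le_left _ _
      have hmin0 : 0 ≤ min 1 (α / ε') := by positivity
      have hm0 : (0 : ℝ) ≤ m := Nat.cast_nonneg m
      have t1 : (m * α + 1) * G * √(Real.log (1 / (α * (1 / 2)))) / ε' ≤
          (m * α + 1) * G * 1 / ε' := by gcongr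
      have t2 : (m * min 1 (α / ε') + 1) * Real.log (1 / (α * (1 / 2))) ≤ (m * 1 + 1) * 1 := by
        have : 0 ≤ Real.log (1 / (α * (1 / 2))) :=
          Real.log_nonneg ((one_le_div (by positivity)).2 (by linarith))
        gcongr
      -- the second part of the cost is dominated by the first one
      have t3 : (m * 1 + 1) * 1 ≤ 8 * ((m * α + 1) * G * 1 / ε') := by
        have h2 : 1 ≤ 1 / ε' := (one_le_div hε'0).2 h1.le
        have h3 : (m * 1 + 1 : ℝ) ≤ 2 * (m * α + 1) := by nlinarith
        calc (m * 1 + 1 : ℝ) * 1 ≤ (2 * (m * α + 1)) * (1 / ε') := by gcongr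
          _ = (2 * (m * α + 1)) * (4 * (1 / 4)) * (1 / ε') := by ring
          _ ≤ (2 * (m * α + 1)) * (4 * G) * (1 / ε') := by gcongr
          _ = _ := by ring
      have t4 : (m * α + 1) * G * 1 / ε' = (m * α + 1) * G * r / ε := by
        rw [hε']
        field_simp
      rw [t4] at t1 t3
      have t5 : 0 ≤ (m * α + 1) * G * r / ε := by positivity
      linarith
    · have := halg A hA hA' i
      norm_num at this ⊢
      exact this

theorem theorem3p1 :
    ∃ C : ℝ, 0 < C ∧
      ∀ (n m : ℕ) (α δ ε : ℝ), 1 ≤ m → 0 < α → α < 1 → 0 < δ → δ < 1 → 0 < ε →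
        ∃ alg : OnlineMatVecAlgorithm n m,
          (alg.totalQueries : ℝ) ≤
              C * ((m * α + 1) * Real.log (2 / α) ^ 2 * √(Real.log (1 / (α * δ))) / ε
                + (m * min 1 (α / ε) + 1) * Real.log (1 / (α * δ))) ∧
            ∀ A : Fin m → Matrix (Fin n) (Fin n) ℝ,
              (∀ i : Fin m, nuclearNorm (A i) ≤ 1) →
              (∀ i j : Fin m, (i : ℕ) + 1 = (j : ℕ) → nuclearNorm (A j - A i) ≤ α) →
              ∀ i : Fin m,
                1 - δ ≤ alg.P.real {ω | |alg.output A i ω - (A i).trace| ≤ ε} := by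
  refine ⟨1000000, by norm_num, fun n m α δ ε hm hα hα1 hδ hδ1 hε => ?_⟩
  have : NeZero m := ⟨by omega⟩
  rcases lt_or_ge (Real.log (1 / (α * δ))) (1 / 16) with hL | hL
  · exact exists_noisy_algorithm hm hα hα1 hδ hδ1 hε hL
  · have hmin0 : 0 ≤ min 1 (α / ε) := by positivity
    have hL0 : 0 ≤ Real.log (1 / (α * δ)) := by linarith
    rcases le_or_gt 1 ε with h1 | h1
    · refine ⟨.trivial n m, ?_, fun A hA hA' i => ?_⟩
      · rw [OnlineMatVecAlgorithm.totalQueries_trivial, Nat.cast_zero]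
        positivity
      · rw [OnlineMatVecAlgorithm.prob_trivial (hA i) h1]
        linarith
    · obtain ⟨alg, hcost, halg⟩ := exists_dyadic_algorithm (n := n) hm hα hα1
        (lt_min hδ one_half_pos) (min_le_right δ (1 / 2)) hε h1
      refine ⟨alg, hcost.trans ?_, fun A hA hA' i => ?_⟩
      · have hlog2' := Real.log_two_lt_d9
        have hL' : Real.log (1 / (α * min δ (1 / 2))) ≤ 16 * Real.log (1 / (α * δ)) := by
          rcases le_total δ (1 / 2) with h | h
          · rw [min_eq_left h]
            linarith
          · rw [min_eq_right h]
            have h2 : 1 / (α * (1 / 2)) ≤ 1 / (α * δ) * 2 := by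
              rw [div_mul_eq_mul_div, div_le_div_iff₀ (by positivity) (by positivity)]
              nlinarith
            have h3 := Real.log_le_log (by positivity) h2
            rw [Real.log_mul (by positivity) two_ne_zero] at h3
            linarith
        have hsqrt : √(Real.log (1 / (α * min δ (1 / 2)))) ≤ 4 * √(Real.log (1 / (α * δ))) := by
          rw [show (4 : ℝ) = √16 by rw [show (16 : ℝ) = 4 ^ 2 by norm_num]; simp,
            ← Real.sqrt_mul (by norm_num)]
          exact Real.sqrt_le_sqrt hL'
        have t1 : (m * α + 1) * Real.log (2 / α) ^ 2 *
            √(Real.log (1 / (α * min δ (1 / 2)))) / ε ≤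
            (m * α + 1) * Real.log (2 / α) ^ 2 * (4 * √(Real.log (1 / (α * δ)))) / ε := by gcongr
        have t2 : (m * min 1 (α / ε) + 1) * Real.log (1 / (α * min δ (1 / 2))) ≤
            (m * min 1 (α / ε) + 1) * (16 * Real.log (1 / (α * δ))) := by gcongr
        have t3 : (m * α + 1) * Real.log (2 / α) ^ 2 * (4 * √(Real.log (1 / (α * δ)))) / ε =
            4 * ((m * α + 1) * Real.log (2 / α) ^ 2 * √(Real.log (1 / (α * δ))) / ε) := by ring
        rw [t3] at t1
        have t4 : 0 ≤ (m * α + 1) * Real.log (2 / α) ^ 2 * √(Real.log (1 / (α * δ))) / ε := by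
          positivity
        have t5 : 0 ≤ (m * min 1 (α / ε) + 1) * Real.log (1 / (α * δ)) := by positivity
        linarith
      · exact le_trans (by linarith [min_le_left δ (1 / 2)]) (halg A hA hA' i)
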